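/- Let $N_4$ be the group of $4\times 4$ lower triangular integer matrices with all diagonal entries equal to $1$. For a homeomorphism $g$ of $[0,1]$ and $x\in[0,1]$, put $$J_g(x):=\Big[\inf_{n\in\mathbb Z} g^n(x),\ \sup_{n\in\mathbb Z} g^n(x)\Big],$$ and say that a homeomorphism $h$ of $[0,1]$ moves $J_g(x)$ if $h(J_g(x))\neq J_g(x)$ and the intervals $h(J_g(x))$ and $J_g(x)$ have disjoint interiors. A diffeomorphism of $[0,1]$ is of class $C^{1+\alpha}$ if it is $C^1$ and its derivative is $\alpha$-Hölder continuous, that is, $|f'(x)-f'(y)|\le C|x-y|^\alpha$ for some $C>0$ and all $x,y\in[0,1]$, and its inverse has the same property. **Lemma.** Suppose that $N_4$ acts faithfully on $[0,1]$ by orientation-preserving $C^{1+\alpha}$ diffeomorphisms for some $\alpha>1/2$. Then there exist $g_1,g_2,g_3\in N_4$ and $x_0\in[0,1]$ such that: 1. $J_{g_3}(x_0)$ is not reduced to a point; 2. $g_2$ moves $J_{g_3}(x_0)$, and $g_1$ moves $J_{g_2}(x_0)$; 3. $g_1,g_2,g_3$ pairwise commute, and the subgroup $\langle g_1,g_2,g_3\rangle$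 of $N_4$ is isomorphic to $\mathbb Z^3$. -/

import Mathlib

open scoped unitInterval

/-- A `4 × 4` integer matrix is lower unitriangular: ones on the diagonal, zeros above it. -/
def IsLowerUnitriangular (M : Matrix (Fin 4) (Fin 4) ℤ) : Prop :=
  (∀ i, M i i = 1) ∧ ∀ i j, i < j → M i j = 0

theorem isLowerUnitriangular_mul {A B : Matrix (Fin 4) (Fin 4) ℤ}
    (hA : IsLowerUnitriangular A) (hB : IsLowerUnitriangular B) :
    IsLowerUnitriangular (A * B) := by
  obtain ⟨a1, a2⟩ := hA
  obtain ⟨b1, b2⟩ := hB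
  constructor
  · intro i
    fin_cases i <;> simp [Matrix.mul_apply, Fin.sum_univ_four, a1, b1, a2, b2]
  · intro i j hij
    fin_cases i <;> fin_cases j <;>
      first
        | (exfalso; revert hij; decide)
        | simp [Matrix.mul_apply, Fin.sum_univ_four, a2, b2]

theorem isLowerUnitriangular_of_mul_eq_one {A B : Matrix (Fin 4) (Fin 4) ℤ}
    (hA : IsLowerUnitriangular A) (h : A * B = 1) : IsLowerUnitriangular B := by
  obtain ⟨a1, a2⟩ := hA
  have h0 : ∀ j, B 0 j = (1 : Matrix (Fin 4) (Fin 4) ℤ) 0 j := by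
    intro j
    have := congrFun (congrFun h 0) j
    simpa [Matrix.mul_apply, Fin.sum_univ_four, a1, a2] using this
  have h1 : ∀ j, A 1 0 * B 0 j + B 1 j = (1 : Matrix (Fin 4) (Fin 4) ℤ) 1 j := by
    intro j
    have := congrFun (congrFun h 1) j
    simpa [Matrix.mul_apply, Fin.sum_univ_four, a1, a2] using this
  have h2 : ∀ j, A 2 0 * B 0 j + A 2 1 * B 1 j + B 2 j
      = (1 : Matrix (Fin 4) (Fin 4) ℤ) 2 j := by
    intro j
    have := congrFun (congrFun h 2) j
    simpa [Matrix.mul_apply, Fin.sum_univ_four, a1, a2] using this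
  have h3 : ∀ j, A 3 0 * B 0 j + A 3 1 * B 1 j + A 3 2 * B 2 j + B 3 j
      = (1 : Matrix (Fin 4) (Fin 4) ℤ) 3 j := by
    intro j
    have := congrFun (congrFun h 3) j
    simpa [Matrix.mul_apply, Fin.sum_univ_four, a1] using this
  have z : ∀ j, 0 < j → B 0 j = 0 := by
    intro j hj
    rw [h0, Matrix.one_apply_ne hj.ne]
  have z1 : ∀ j, 1 < j → B 1 j = 0 := by
    intro j hj
    have := h1 j
    rw [z j (lt_trans (by decide) hj), Matrix.one_apply_ne hj.ne] at this
    simpa using this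
  have z2 : ∀ j, 2 < j → B 2 j = 0 := by
    intro j hj
    have := h2 j
    rw [z j (lt_trans (by decide) hj), z1 j (lt_trans (by decide) hj),
      Matrix.one_apply_ne hj.ne] at this
    simpa using this
  constructor
  · intro i
    fin_cases i
    · simpa using h0 0
    · simpa [z 1 (by decide)] using h1 1
    · simpa [z 2 (by decide), z1 2 (by decide)] using h2 2
    · simpa [z 3 (by decide), z1 3 (by decide), z2 3 (by decide)] using h3 3
  · intro i j hij
    fin_cases i
    · exact z j hij
    · exact z1 j hij
    · exact z2 j hij
    · exact absurd hij (by revert j; decide)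

/-- The group `N₄` of `4 × 4` lower triangular matrices with integer entries and ones on the
diagonal, as a subgroup of the invertible integer matrices. -/
def N4 : Subgroup (Matrix (Fin 4) (Fin 4) ℤ)ˣ where
  carrier := {u | IsLowerUnitriangular (u : Matrix (Fin 4) (Fin 4) ℤ)}
  one_mem' := ⟨fun i => by simp, fun i j hij => by simp [Matrix.one_apply_ne hij.ne]⟩
  mul_mem' := fun ha hb => isLowerUnitriangular_mul ha hb
  inv_mem' := fun {u} hu => isLowerUnitriangular_of_mul_eq_one hu u.mul_inv

/-- A self-map of `[0,1]`, viewed as a real function. Only its values on `[0,1]` matter below. -/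
noncomputable def toRealFun (f : I → I) (t : ℝ) : ℝ :=
  f (Set.projIcc (0 : ℝ) 1 zero_le_one t)

/-- `f : [0,1] → [0,1]` is of class `C^{1+α}`: it is `C¹` on `[0,1]` (one-sided derivatives at the
endpoints) and its derivative is `α`-Hölder continuous. -/
def IsC1Holder (α : ℝ) (f : I → I) : Prop :=
  ContDiffOn ℝ 1 (toRealFun f) (Set.Icc 0 1) ∧
    ∃ C > 0, ∀ x ∈ Set.Icc (0 : ℝ) 1, ∀ y ∈ Set.Icc (0 : ℝ) 1,
      |derivWithin (toRealFun f) (Set.Icc 0 1) x - derivWithin (toRealFun f) (Set.Icc 0 1) y|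
        ≤ C * |x - y| ^ α

/-- `f` belongs to `Diff₊^{1+α}([0,1])`: it is an orientation-preserving homeomorphism of `[0,1]`
such that `f` and its inverse are of class `C^{1+α}`. -/
def IsOrientedC1HolderDiffeo (α : ℝ) (f : I ≃ₜ I) : Prop :=
  StrictMono f ∧ IsC1Holder α f ∧ IsC1Holder α f.symm

/-- The interval `J_g(x) = [inf_n gⁿ(x), sup_n gⁿ(x)]`, with `n` ranging over `ℤ`. -/
noncomputable def orbitInterval (g : I ≃ₜ I) (x : I) : Set I :=
  {y | (⨅ n : ℤ, (((g ^ n) x : I) : ℝ)) ≤ y ∧ (y : ℝ) ≤ ⨆ n : ℤ, (((g ^ n) x : I) : ℝ)}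

/-- `h` moves the interval `J`: the image `h(J)` differs from `J` and the two have disjoint
interiors. -/
def Moves (h : I ≃ₜ I) (J : Set I) : Prop :=
  h '' J ≠ J ∧ Disjoint (interior (h '' J)) (interior J)

/-! Take for `g₃` the generator `z` of the centre and for `x₀` a point `x` that `z` moves;
faithfulness provides one. Let `S` be the stabilizer of the endpoints of J_z(x). Inside J_z(x) the
powers of `z` act like integer translations, so counting how far orbits of `x` travel shows that no
commutator of two elements of `S` is a nontrivial power of `z` (`commutator_eq_zero`). Matrices with
vanishing (2,1) entry form a Heisenberg group whose commutator is a symplectic form on ℤ⁴. If `S`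
met all four coordinate Lagrangian planes nontrivially, two of its elements would pair nontrivially;
hence some copy of ℤ² meets `S` trivially (`exists_commute_independent_mod`).

Every nontrivial element of this ℤ² moves J_z(x), which is therefore a wandering interval. Suppose
no γ₁ in ℤ² moves J_{γ₂}(x) for any γ₂ ≠ 1. Then all the J_γ(x) with γ ≠ 1 coincide, and ℤ² acts
freely on the interior of this common interval while having a wandering interval there. A Denjoy
theorem (`not_wandering_of_free`) rules this out when α > 1/2. So some γ₁ moves some J_{γ₂}(x), and
γ₁, γ₂, z are the required elements.

The Denjoy theorem averages distortion over lattice paths in the quadrant. The images of the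
wandering interval are disjoint, so their lengths have bounded sum; for α > 1/2 this bounds the sum,
over antidiagonals, of the average of length^α. Hence on each antidiagonal some element has
distortion bounded independently of the antidiagonal, even slightly beyond the interval. An element
that strongly contracts the interval is transported by these maps to near the endpoint `B`, where it
still contracts strongly. This contradicts a lower bound on its slope at `B`. -/

/-! ### Orbit intervals of homeomorphisms of `[0,1]` -/

/-- The left endpoint of `orbitInterval g x`. -/
noncomputable def orbitInf (g : I ≃ₜ I) (x : I) : I := ⨅ n : ℤ, (g ^ n) x

/-- The right endpoint of `orbitInterval g x`. -/
noncomputable def orbitSup (g : I ≃ₜ I) (x : I) : I := ⨆ n : ℤ, (g ^ n) x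

theorem isGLB_orbitInf (g : I ≃ₜ I) (x : I) :
    IsGLB (Set.range fun n : ℤ => (g ^ n) x) (orbitInf g x) := isGLB_iInf

theorem isLUB_orbitSup (g : I ≃ₜ I) (x : I) :
    IsLUB (Set.range fun n : ℤ => (g ^ n) x) (orbitSup g x) := isLUB_iSup

theorem zpow_apply_mem_Icc (g : I ≃ₜ I) (x : I) (n : ℤ) :
    (g ^ n) x ∈ Set.Icc (orbitInf g x) (orbitSup g x) :=
  ⟨(isGLB_orbitInf g x).1 ⟨n, rfl⟩, (isLUB_orbitSup g x).1 ⟨n, rfl⟩⟩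

theorem orbitInf_le (g : I ≃ₜ I) (x : I) : orbitInf g x ≤ x := by
  simpa using (zpow_apply_mem_Icc g x 0).1

theorem le_orbitSup (g : I ≃ₜ I) (x : I) : x ≤ orbitSup g x := by
  simpa using (zpow_apply_mem_Icc g x 0).2

theorem coe_orbitInf (g : I ≃ₜ I) (x : I) :
    ((orbitInf g x : I) : ℝ) = ⨅ n : ℤ, (((g ^ n) x : I) : ℝ) := by
  have hb : BddBelow (Set.range fun n : ℤ => (((g ^ n) x : I) : ℝ)) :=
    ⟨0, by rintro _ ⟨n, rfl⟩; exact ((g ^ n) x).2.1⟩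
  have h1 : ((⟨⨅ n : ℤ, (((g ^ n) x : I) : ℝ), le_ciInf fun n => ((g ^ n) x).2.1,
      (ciInf_le hb 0).trans ((g ^ (0 : ℤ)) x).2.2⟩ : I)) = orbitInf g x := by
    refine IsGLB.unique ⟨?_, ?_⟩ (isGLB_orbitInf g x)
    · rintro _ ⟨n, rfl⟩
      exact ciInf_le hb n
    · intro y hy
      exact (le_ciInf fun n => hy ⟨n, rfl⟩ : (y : ℝ) ≤ ⨅ n : ℤ, (((g ^ n) x : I) : ℝ))
  rw [← h1]

theorem coe_orbitSup (g : I ≃ₜ I) (x : I) :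
    ((orbitSup g x : I) : ℝ) = ⨆ n : ℤ, (((g ^ n) x : I) : ℝ) := by
  have hb : BddAbove (Set.range fun n : ℤ => (((g ^ n) x : I) : ℝ)) :=
    ⟨1, by rintro _ ⟨n, rfl⟩; exact ((g ^ n) x).2.2⟩
  have h1 : ((⟨⨆ n : ℤ, (((g ^ n) x : I) : ℝ),
      ((g ^ (0 : ℤ)) x).2.1.trans (le_ciSup hb 0), ciSup_le fun n => ((g ^ n) x).2.2⟩ : I))
      = orbitSup g x := by
    refine IsLUB.unique ⟨?_, ?_⟩ (isLUB_orbitSup g x)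
    · rintro _ ⟨n, rfl⟩
      exact le_ciSup hb n
    · intro y hy
      exact (ciSup_le fun n => hy ⟨n, rfl⟩ : (⨆ n : ℤ, (((g ^ n) x : I) : ℝ)) ≤ (y : ℝ))
  rw [← h1]

theorem orbitInterval_eq_Icc (g : I ≃ₜ I) (x : I) :
    orbitInterval g x = Set.Icc (orbitInf g x) (orbitSup g x) := by
  ext y
  rw [orbitInterval, Set.mem_ofPred_eq, ← coe_orbitInf, ← coe_orbitSup]
  rfl

/-- A strictly monotone homeomorphism of `[0,1]` as an order isomorphism. -/
def StrictMono.homeoOrderIso {h : I ≃ₜ I} (hh : StrictMono h) : I ≃o I where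
  toEquiv := h.toEquiv
  map_rel_iff' := hh.le_iff_le

theorem StrictMono.homeo_image_Icc {h : I ≃ₜ I} (hh : StrictMono h) (a b : I) :
    h '' Set.Icc a b = Set.Icc (h a) (h b) :=
  hh.homeoOrderIso.image_Icc a b

theorem image_range_zpow {g h : I ≃ₜ I} (hc : Commute h g) (x : I) :
    (h '' Set.range fun n : ℤ => (g ^ n) x) = Set.range fun n : ℤ => (g ^ n) (h x) := by
  rw [← Set.range_comp]
  congr 1
  ext1 n
  exact DFunLike.congr_fun (hc.zpow_right n).eq x

theorem apply_orbitInf {g h : I ≃ₜ I} (hh : StrictMono h) (hc : Commute h g) (x : I) :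
    h (orbitInf g x) = orbitInf g (h x) := by
  refine IsGLB.unique ?_ (isGLB_orbitInf g (h x))
  rw [← image_range_zpow hc]
  exact hh.homeoOrderIso.isGLB_image'.2 (isGLB_orbitInf g x)

theorem apply_orbitSup {g h : I ≃ₜ I} (hh : StrictMono h) (hc : Commute h g) (x : I) :
    h (orbitSup g x) = orbitSup g (h x) := by
  refine IsLUB.unique ?_ (isLUB_orbitSup g (h x))
  rw [← image_range_zpow hc]
  exact hh.homeoOrderIso.isLUB_image'.2 (isLUB_orbitSup g x)

theorem range_zpow_apply_self (g : I ≃ₜ I) (x : I) :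
    (Set.range fun n : ℤ => (g ^ n) (g x)) = Set.range fun n : ℤ => (g ^ n) x := by
  have : (fun n : ℤ => (g ^ n) (g x)) = (fun n : ℤ => (g ^ n) x) ∘ Equiv.addRight (1 : ℤ) := by
    ext1 n
    simp [zpow_add, Homeomorph.mul_apply]
  rw [this, EquivLike.range_comp]

theorem apply_orbitInf_self {g : I ≃ₜ I} (hg : StrictMono g) (x : I) :
    g (orbitInf g x) = orbitInf g x := by
  rw [apply_orbitInf hg (Commute.refl g)]
  refine IsGLB.unique (isGLB_orbitInf g (g x)) ?_
  rw [range_zpow_apply_self]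
  exact isGLB_orbitInf g x

theorem apply_orbitSup_self {g : I ≃ₜ I} (hg : StrictMono g) (x : I) :
    g (orbitSup g x) = orbitSup g x := by
  rw [apply_orbitSup hg (Commute.refl g)]
  refine IsLUB.unique (isLUB_orbitSup g (g x)) ?_
  rw [range_zpow_apply_self]
  exact isLUB_orbitSup g x

theorem orbitInf_inv (g : I ≃ₜ I) (x : I) : orbitInf g⁻¹ x = orbitInf g x := by
  unfold orbitInf
  rw [← (Equiv.neg ℤ).iInf_comp]
  simp

theorem orbitSup_inv (g : I ≃ₜ I) (x : I) : orbitSup g⁻¹ x = orbitSup g x := by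
  unfold orbitSup
  rw [← (Equiv.neg ℤ).iSup_comp]
  simp

theorem zpow_apply_of_fixed {g : I ≃ₜ I} {y : I} (hy : g y = y) (n : ℤ) : (g ^ n) y = y := by
  let S : Subgroup (I ≃ₜ I) :=
    { carrier := {h | h y = y}
      one_mem' := rfl
      mul_mem' := fun {a b} (ha : a y = y) (hb : b y = y) => by
        change a (b y) = y
        rw [hb, ha]
      inv_mem' := fun {a} (ha : a y = y) => by
        change a.symm y = y
        rw [Homeomorph.symm_apply_eq, ha] }
  exact S.zpow_mem (show g ∈ S from hy) n

/-! ### Orbit intervals and fixed points for an increasing group action. -/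

section Action

variable {G : Type*} [Group G] {ρ : G →* (I ≃ₜ I)}

theorem action_mul_apply (g h : G) (x : I) : ρ (g * h) x = ρ g (ρ h x) := by
  rw [map_mul, Homeomorph.mul_apply]

theorem action_inv_apply_eq_iff (g : G) (x y : I) : ρ g⁻¹ x = y ↔ x = ρ g y := by
  rw [map_inv]
  exact (ρ g).symm_apply_eq

theorem action_inv_apply_self (g : G) (x : I) : ρ g⁻¹ (ρ g x) = x :=
  (action_inv_apply_eq_iff g _ _).2 rfl

theorem strictMono_zpow (hρ : ∀ g, StrictMono (ρ g)) (g : G) (n : ℤ) :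
    StrictMono ((ρ g) ^ n : I ≃ₜ I) := by
  rw [← map_zpow]
  exact hρ _

theorem le_orbitInf_of_fixed (hρ : ∀ g, StrictMono (ρ g)) {g : G} {x y : I}
    (hy : ρ g y = y) (hyx : y ≤ x) : y ≤ orbitInf (ρ g) x :=
  (isGLB_orbitInf (ρ g) x).2 (by
    rintro _ ⟨n, rfl⟩
    calc y = ((ρ g) ^ n) y := (zpow_apply_of_fixed hy n).symm
      _ ≤ ((ρ g) ^ n) x := (strictMono_zpow hρ g n).monotone hyx)

theorem orbitSup_le_of_fixed (hρ : ∀ g, StrictMono (ρ g)) {g : G} {x y : I}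
    (hy : ρ g y = y) (hyx : x ≤ y) : orbitSup (ρ g) x ≤ y :=
  (isLUB_orbitSup (ρ g) x).2 (by
    rintro _ ⟨n, rfl⟩
    calc ((ρ g) ^ n) x ≤ ((ρ g) ^ n) y := (strictMono_zpow hρ g n).monotone hyx
      _ = y := zpow_apply_of_fixed hy n)

theorem orbitInf_lt_self (hρ : ∀ g, StrictMono (ρ g)) {g : G} {x : I} (hx : ρ g x ≠ x) :
    orbitInf (ρ g) x < x :=
  (orbitInf_le _ _).lt_of_ne fun h => hx (by rw [← h, apply_orbitInf_self (hρ g)])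

theorem self_lt_orbitSup (hρ : ∀ g, StrictMono (ρ g)) {g : G} {x : I} (hx : ρ g x ≠ x) :
    x < orbitSup (ρ g) x :=
  (le_orbitSup _ _).lt_of_ne fun h => hx (by rw [h, apply_orbitSup_self (hρ g)])

/-- An element commuting with `g` permutes the orbit intervals of `g`. -/
theorem fixes_or_disjoint (hρ : ∀ g, StrictMono (ρ g)) {g h : G} (hc : Commute h g) {x : I}
    (hx : ρ g x ≠ x) :
    (ρ h (orbitInf (ρ g) x) = orbitInf (ρ g) x ∧ ρ h (orbitSup (ρ g) x) = orbitSup (ρ g) x) ∨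
      ρ h (orbitSup (ρ g) x) ≤ orbitInf (ρ g) x ∨ orbitSup (ρ g) x ≤ ρ h (orbitInf (ρ g) x) := by
  have hlt := (orbitInf_lt_self hρ hx).trans (self_lt_orbitSup hρ hx)
  set a := orbitInf (ρ g) x with ha
  set b := orbitSup (ρ g) x with hb
  have fixA : ∀ k, Commute k g → ρ g (ρ k a) = ρ k a := fun k hk => by
    rw [← action_mul_apply, ← hk.eq, action_mul_apply, ha, apply_orbitInf_self (hρ g)]
  have fixB : ∀ k, Commute k g → ρ g (ρ k b) = ρ k b := fun k hk => by
    rw [← action_mul_apply, ← hk.eq, action_mul_apply, hb, apply_orbitSup_self (hρ g)]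
  -- `g` has no fixed point strictly between `a` and `b`, while elements commuting with `g` permute
  -- its fixed points. If `h` maps the interval over itself, the same fact for `h⁻¹` forces
  -- equality.
  have key : ∀ y, ρ g y = y → y ≤ a ∨ b ≤ y := fun y hy => by
    rcases le_total y x with h1 | h1
    · exact Or.inl (le_orbitInf_of_fixed hρ hy h1)
    · exact Or.inr (orbitSup_le_of_fixed hρ hy h1)
  have hinv : ∀ y, ρ h⁻¹ (ρ h y) = y := action_inv_apply_self h
  rcases key _ (fixA h hc) with h1 | h1
  · rcases key _ (fixB h hc) with h2 | h2
    · exact Or.inr (Or.inl h2)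
    · left
      have h3 : a ≤ ρ h⁻¹ a := by
        simpa [hinv] using (hρ h⁻¹).monotone h1
      have h4 : ρ h⁻¹ b ≤ b := by
        simpa [hinv] using (hρ h⁻¹).monotone h2
      constructor
      · refine ((action_inv_apply_eq_iff h a a).1 ?_).symm
        rcases key _ (fixA h⁻¹ hc.inv_left) with h5 | h5
        · exact le_antisymm h5 h3
        · exact absurd ((h5.trans_lt (hρ h⁻¹ hlt)).trans_le h4) (lt_irrefl _)
      · refine ((action_inv_apply_eq_iff h b b).1 ?_).symm
        rcases key _ (fixB h⁻¹ hc.inv_left) with h5 | h5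
        · exact absurd ((h3.trans_lt (hρ h⁻¹ hlt)).trans_le h5) (lt_irrefl _)
        · exact le_antisymm h4 h5
  · exact Or.inr (Or.inr h1)

theorem moves_orbitInterval (hρ : ∀ g, StrictMono (ρ g)) {g h : G} (hc : Commute h g) {x : I}
    (hx : ρ g x ≠ x)
    (hne : ¬ (ρ h (orbitInf (ρ g) x) = orbitInf (ρ g) x ∧
      ρ h (orbitSup (ρ g) x) = orbitSup (ρ g) x)) :
    Moves (ρ h) (orbitInterval (ρ g) x) := by
  have hlt := (orbitInf_lt_self hρ hx).trans (self_lt_orbitSup hρ hx)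
  have hd := (fixes_or_disjoint hρ hc hx).resolve_left hne
  rw [orbitInterval_eq_Icc]
  set a := orbitInf (ρ g) x
  set b := orbitSup (ρ g) x
  have hab := hρ h hlt
  refine ⟨?_, ?_⟩ <;> rw [(hρ h).homeo_image_Icc]
  · intro he
    obtain ⟨h1, h2⟩ := (Set.Icc_eq_Icc_iff hab.le).1 he
    exact hne ⟨h1, h2⟩
  · rw [Set.disjoint_iff_inter_eq_empty, ← interior_inter, Set.Icc_inter_Icc]
    rcases hd with h1 | h1
    · rw [max_eq_right (hab.le.trans h1), min_eq_left (h1.trans hlt.le)]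
      rcases h1.lt_or_eq with h2 | h2
      · rw [Set.Icc_eq_empty (not_le.2 h2), interior_empty]
      · rw [h2, Set.Icc_self, interior_singleton]
    · rw [max_eq_left (hlt.le.trans h1), min_eq_right (h1.trans hab.le)]
      rcases h1.lt_or_eq with h2 | h2
      · rw [Set.Icc_eq_empty (not_le.2 h2), interior_empty]
      · rw [← h2, Set.Icc_self, interior_singleton]

theorem strictMono_zpow_apply (hρ : ∀ g, StrictMono (ρ g)) {g : G} {y : I} (h : y < ρ g y) :
    StrictMono fun m : ℤ => ρ (g ^ m) y :=
  strictMono_int_of_lt_succ fun m => by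
    simpa only [zpow_add, zpow_one, action_mul_apply] using hρ (g ^ m) h

/-- Increasing maps have no finite nontrivial orbits: a point that moves keeps moving in the same
direction. -/
theorem fixed_of_zpow_fixed (hρ : ∀ g, StrictMono (ρ g)) {g : G} {n : ℤ} (hn : n ≠ 0) {y : I}
    (hy : ρ (g ^ n) y = y) : ρ g y = y := by
  rcases lt_trichotomy (ρ g y) y with h | h | h
  · have h1 : y < ρ g⁻¹ y := by simpa [action_inv_apply_self] using hρ g⁻¹ h
    have := (strictMono_zpow_apply hρ h1).injective (a₁ := -n) (a₂ := 0) (by simpa using hy)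
    omega
  · exact h
  · exact absurd ((strictMono_zpow_apply hρ h).injective (a₁ := n) (a₂ := 0)
      (by simpa using hy)) hn

/-- The orbit of `y` serves as a ruler, cutting the orbit interval into fundamental domains. -/
theorem exists_zpow_le_lt (hρ : ∀ g, StrictMono (ρ g)) {g : G} {y z : I} (h : y < ρ g y)
    (hz : orbitInf (ρ g) y < z) (hz' : z < orbitSup (ρ g) y) :
    ∃ k : ℤ, ρ (g ^ k) y ≤ z ∧ z < ρ (g ^ (k + 1)) y := by
  have hm := strictMono_zpow_apply hρ h
  obtain ⟨_, ⟨k0, rfl⟩, hk0⟩ := ((isGLB_lt_iff (isGLB_orbitInf (ρ g) y)).1 hz)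
  obtain ⟨_, ⟨k1, rfl⟩, hk1⟩ := ((lt_isLUB_iff (isLUB_orbitSup (ρ g) y)).1 hz')
  simp only [← map_zpow] at hk0 hk1
  obtain ⟨k, hk, hk'⟩ := Int.exists_greatest_of_bdd (P := fun k => ρ (g ^ k) y ≤ z)
    ⟨k1, fun j hj => (hm.lt_iff_lt.1 (hj.trans_lt hk1)).le⟩ ⟨k0, hk0.le⟩
  exact ⟨k, hk, not_le.1 fun hc => by have := hk' _ hc; omega⟩

end Action

/-! ### Distortion of `C^{1+α}` diffeomorphisms -/

theorem toRealFun_coe (f : I → I) (x : I) : toRealFun f (x : ℝ) = f x := by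
  simp [toRealFun, Set.projIcc_val]

/-- The mean value theorem for a `C^{1+α}` self-map of `[0,1]`. -/
theorem IsC1Holder.exists_slope {α : ℝ} {f : I → I} (hf : IsC1Holder α f) {u v : I} (h : u < v) :
    ∃ ξ ∈ Set.Ioo (u : ℝ) v,
      ((f v : ℝ) - f u) = derivWithin (toRealFun f) (Set.Icc 0 1) ξ * (v - u) := by
  have hsub : Set.Icc (u : ℝ) v ⊆ Set.Icc 0 1 := Set.Icc_subset_Icc u.2.1 v.2.2
  have hd := hf.1.differentiableOn one_ne_zero
  have huv : (u : ℝ) < v := h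
  obtain ⟨ξ, hξ, he⟩ := exists_hasDerivAt_eq_slope (toRealFun f)
    (derivWithin (toRealFun f) (Set.Icc 0 1)) huv (hf.1.continuousOn.mono hsub) (fun x hx => by
      have hx' : x ∈ Set.Ioo (0 : ℝ) 1 := ⟨u.2.1.trans_lt hx.1, hx.2.trans_le v.2.2⟩
      exact (hd x (Set.Ioo_subset_Icc_self hx')).hasDerivWithinAt.hasDerivAt
        (Icc_mem_nhds hx'.1 hx'.2))
  refine ⟨ξ, hξ, ?_⟩
  rw [he, toRealFun_coe, toRealFun_coe]
  have : (v : ℝ) - u ≠ 0 := (sub_pos.2 huv).ne'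
  field_simp

theorem IsC1Holder.exists_lipschitz {α : ℝ} (hα : 0 < α) {f : I → I} (hf : IsC1Holder α f) :
    ∃ L > 0, ∀ u v : I, u ≤ v → ((f v : ℝ) - f u) ≤ L * (v - u) := by
  obtain ⟨C, hC, hH⟩ := hf.2
  set D := derivWithin (toRealFun f) (Set.Icc 0 1)
  refine ⟨|D 0| + C, by positivity, fun u v huv => ?_⟩
  rcases huv.eq_or_lt with rfl | h
  · simp
  obtain ⟨ξ, hξ, he⟩ := hf.exists_slope h
  rw [he]
  have h01 : ξ ∈ Set.Icc (0 : ℝ) 1 := ⟨u.2.1.trans hξ.1.le, hξ.2.le.trans v.2.2⟩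
  refine mul_le_mul_of_nonneg_right ?_ (sub_nonneg.2 (show (u : ℝ) ≤ v from huv))
  have h1 := hH ξ h01 0 (by simp)
  have h2 : |ξ - 0| ^ α ≤ 1 := by
    rw [sub_zero, abs_of_nonneg h01.1]
    exact Real.rpow_le_one h01.1 h01.2 hα.le
  have h3 : C * |ξ - 0| ^ α ≤ C := by nlinarith
  have h4 := le_abs_self (D 0)
  have h5 := le_abs_self (D ξ - D 0)
  change D ξ ≤ _
  linarith

/-- A homeomorphism of `[0,1]` expands lengths by at least a definite factor. -/
def ExpandsBy (κ : ℝ) (f : I → I) : Prop :=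
  ∀ u v : I, u ≤ v → κ * ((v : ℝ) - u) ≤ (f v : ℝ) - f u

/-- On an interval of length `ℓ`, the slopes of `f` differ at most by the factor
`exp (C * ℓ ^ α)`. -/
def HolderDistortion (C α : ℝ) (f : I → I) : Prop :=
  ∀ s t u₁ u₂ v₁ v₂ : I, s ≤ u₁ → u₁ ≤ u₂ → u₂ ≤ t → s ≤ v₁ → v₁ ≤ v₂ → v₂ ≤ t →
    ((f u₂ : ℝ) - f u₁) * (v₂ - v₁) ≤
      Real.exp (C * ((t : ℝ) - s) ^ α) * (((f v₂ : ℝ) - f v₁) * (u₂ - u₁))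

/-- The inverse is Lipschitz, its derivative being bounded. -/
theorem IsOrientedC1HolderDiffeo.exists_expandsBy {α : ℝ} (hα : 0 < α) {f : I ≃ₜ I}
    (hf : IsOrientedC1HolderDiffeo α f) : ∃ κ > 0, ExpandsBy κ f := by
  obtain ⟨L, hL, h⟩ := hf.2.2.exists_lipschitz hα
  refine ⟨L⁻¹, inv_pos.2 hL, fun u v huv => ?_⟩
  have := h _ _ (hf.1.monotone huv)
  rw [Homeomorph.symm_apply_apply, Homeomorph.symm_apply_apply] at this
  rwa [inv_mul_le_iff₀ hL]

/-- By the mean value theorem slopes are derivatives, and these are at least κ. A Hölder oscillation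
of size C·w is then at most the factor 1 + C·w/κ, hence at most exp(C·w/κ). -/
theorem IsOrientedC1HolderDiffeo.exists_holderDistortion {α : ℝ} (hα : 0 < α) {f : I ≃ₜ I}
    (hf : IsOrientedC1HolderDiffeo α f) : ∃ C > 0, HolderDistortion C α f := by
  obtain ⟨C, hC, hH⟩ := hf.2.1.2
  obtain ⟨κ, hκ, hexp⟩ := hf.exists_expandsBy hα
  set D := derivWithin (toRealFun f) (Set.Icc 0 1)
  refine ⟨C / κ, by positivity, fun s t u₁ u₂ v₁ v₂ hs hu ht hs' hv ht' => ?_⟩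
  rcases hu.eq_or_lt with rfl | hu
  · simp
  rcases hv.eq_or_lt with rfl | hv
  · simp
  obtain ⟨ξ, hξ, heξ⟩ := hf.2.1.exists_slope hu
  obtain ⟨η, hη, heη⟩ := hf.2.1.exists_slope hv
  have hu' : (0 : ℝ) < u₂ - u₁ := sub_pos.2 hu
  have hv' : (0 : ℝ) < v₂ - v₁ := sub_pos.2 hv
  have hκη : κ ≤ D η := by
    have := hexp _ _ hv.le
    rw [heη] at this
    exact le_of_mul_le_mul_right this hv'
  have hdist : |ξ - η| ^ α ≤ ((t : ℝ) - s) ^ α := by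
    have e1 : (s : ℝ) ≤ u₁ := hs
    have e2 : (u₂ : ℝ) ≤ t := ht
    have e3 : (s : ℝ) ≤ v₁ := hs'
    have e4 : (v₂ : ℝ) ≤ t := ht'
    refine Real.rpow_le_rpow (abs_nonneg _) ?_ hα.le
    rw [abs_le]
    constructor <;> linarith [hξ.1, hξ.2, hη.1, hη.2]
  have h1 := hH ξ ⟨u₁.2.1.trans hξ.1.le, hξ.2.le.trans u₂.2.2⟩ η
    ⟨v₁.2.1.trans hη.1.le, hη.2.le.trans v₂.2.2⟩
  set w := ((t : ℝ) - s) ^ α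
  have hw : 0 ≤ w := (Real.rpow_nonneg (abs_nonneg _) _).trans hdist
  have h2 : D ξ ≤ D η + C * w :=
    by linarith [le_abs_self (D ξ - D η), mul_le_mul_of_nonneg_left hdist hC.le]
  have h3 : C * w ≤ (C / κ * w) * D η := by
    have : C * w = (C / κ * w) * κ := by field_simp
    rw [this]
    exact mul_le_mul_of_nonneg_left hκη (by positivity)
  have h4 : D ξ ≤ Real.exp (C / κ * w) * D η := by
    have := mul_le_mul_of_nonneg_right (Real.add_one_le_exp (C / κ * w)) (hκ.le.trans hκη)
    linarith
  rw [heξ, heη]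
  calc D ξ * (u₂ - u₁) * (v₂ - v₁) = D ξ * ((u₂ - u₁) * (v₂ - v₁)) := by ring
    _ ≤ Real.exp (C / κ * w) * D η * ((u₂ - u₁) * (v₂ - v₁)) :=
        mul_le_mul_of_nonneg_right h4 (by positivity)
    _ = _ := by ring

/-- Allows α < 1 to be assumed, as the averaging estimate needs. -/
theorem IsC1Holder.of_le {α β : ℝ} (hβ : 0 < β) (h : β ≤ α) {f : I → I} (hf : IsC1Holder α f) :
    IsC1Holder β f := by
  obtain ⟨C, hC, hH⟩ := hf.2
  refine ⟨hf.1, C, hC, fun x hx y hy => (hH x hx y hy).trans ?_⟩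
  refine mul_le_mul_of_nonneg_left ?_ hC.le
  rcases (abs_nonneg (x - y)).eq_or_lt with h0 | h0
  · rw [← h0, Real.zero_rpow (hβ.trans_le h).ne', Real.zero_rpow hβ.ne']
  · exact Real.rpow_le_rpow_of_exponent_ge h0
      (abs_le.2 ⟨by linarith [hx.1, hy.2], by linarith [hx.2, hy.1]⟩) h

theorem IsOrientedC1HolderDiffeo.of_le {α β : ℝ} (hβ : 0 < β) (h : β ≤ α) {f : I ≃ₜ I}
    (hf : IsOrientedC1HolderDiffeo α f) : IsOrientedC1HolderDiffeo β f :=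
  ⟨hf.1, hf.2.1.of_le hβ h, hf.2.2.of_le hβ h⟩

/-! ### Averaging over antidiagonals -/

/-- If a cost on the quadrant `ℕ × ℕ` grows by at most `w i j` along each of the two edges leaving
`(i, j)`, then its average over the `n`-th antidiagonal is at most the sum of the averages of `w`
over the previous antidiagonals. -/
theorem exists_cost_antidiagonal {P : ℕ → ℕ → ℝ → Prop} {w : ℕ → ℕ → ℝ}
    (mono : ∀ i j K K', K ≤ K' → P i j K → P i j K') (zero : P 0 0 0)
    (left : ∀ i j K, P i j K → P (i + 1) j (K + w i j))
    (right : ∀ i j K, P i j K → P i (j + 1) (K + w i j)) (n : ℕ) :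
    ∃ d : ℕ → ℝ, (∀ i ≤ n, P i (n - i) (d i)) ∧
      ∑ i ∈ Finset.range (n + 1), d i ≤
        (n + 1) * ∑ k ∈ Finset.range n,
          (1 / ((k : ℝ) + 1)) * ∑ i ∈ Finset.range (k + 1), w i (k - i) := by
  induction n with
  | zero => exact ⟨fun _ => 0, fun i hi => by simpa [Nat.le_zero.1 hi] using zero, by simp⟩
  | succ n ih =>
    obtain ⟨d, hP, hs⟩ := ih
    set e : ℕ → ℝ := fun i => d i + w i (n - i) with he
    have hn : (0 : ℝ) < n + 1 := by positivity
    -- These weights are the backward transition probabilities of a random path that is uniform on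
    -- every antidiagonal. Each `e i` is used with total weight (n+2)/(n+1), so averages are
    -- preserved.
    refine ⟨fun i => (i / (n + 1 : ℝ)) * e (i - 1) + ((n + 1 - i) / (n + 1 : ℝ)) * e i, ?_, ?_⟩
    · intro i hi
      have hA : 0 < i → P i (n + 1 - i) (e (i - 1)) := fun h => by
        have := left (i - 1) (n - (i - 1)) _ (hP (i - 1) (by omega))
        rw [show i - 1 + 1 = i by omega] at this
        rwa [show n + 1 - i = n - (i - 1) by omega]
      have hB : i ≤ n → P i (n + 1 - i) (e i) := fun h => by
        have := right i (n - i) _ (hP i h)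
        rwa [show n - i + 1 = n + 1 - i by omega] at this
      rcases Nat.eq_zero_or_pos i with rfl | h0
      · have := hB (Nat.zero_le _)
        simpa [hn.ne'] using this
      rcases hi.eq_or_lt with rfl | h1
      · have := hA h0
        push_cast
        simpa [hn.ne'] using this
      have hin : (i : ℝ) ≤ n := by exact_mod_cast (by omega : i ≤ n)
      have hsum : (i / (n + 1 : ℝ)) + ((n + 1 - i) / (n + 1 : ℝ)) = 1 := by field_simp; ring
      have ha : 0 ≤ (i / (n + 1 : ℝ)) := by positivity
      have hb : 0 ≤ ((n + 1 - i) / (n + 1 : ℝ)) := div_nonneg (by linarith) hn.le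
      -- A convex combination dominates the smaller term, so the path through the cheaper
      -- predecessor suffices.
      rcases le_total (e (i - 1)) (e i) with h2 | h2
      · refine mono _ _ _ _ ?_ (hA h0)
        change _ ≤ (i / (n + 1 : ℝ)) * e (i - 1) + ((n + 1 - i) / (n + 1 : ℝ)) * e i
        have h3 := mul_le_mul_of_nonneg_left h2 hb
        calc e (i - 1) = (i / (n + 1 : ℝ) + (n + 1 - i) / (n + 1 : ℝ)) * e (i - 1) := by
              rw [hsum, one_mul]
          _ ≤ _ := by rw [add_mul]; linarith
      · refine mono _ _ _ _ ?_ (hB (by omega))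
        change _ ≤ (i / (n + 1 : ℝ)) * e (i - 1) + ((n + 1 - i) / (n + 1 : ℝ)) * e i
        have h3 := mul_le_mul_of_nonneg_left h2 ha
        calc e i = (i / (n + 1 : ℝ) + (n + 1 - i) / (n + 1 : ℝ)) * e i := by
              rw [hsum, one_mul]
          _ ≤ _ := by rw [add_mul]; linarith
    · have h1 : ∑ i ∈ Finset.range (n + 1 + 1), (i / (n + 1 : ℝ)) * e (i - 1)
          = ∑ i ∈ Finset.range (n + 1), ((i + 1) / (n + 1 : ℝ)) * e i := by
        rw [Finset.sum_range_succ']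
        simp
      have h2 : ∑ i ∈ Finset.range (n + 1 + 1), ((n + 1 - i) / (n + 1 : ℝ)) * e i
          = ∑ i ∈ Finset.range (n + 1), ((n + 1 - i) / (n + 1 : ℝ)) * e i := by
        rw [Finset.sum_range_succ]
        simp
      have h3 : ∑ i ∈ Finset.range (n + 1 + 1),
          ((i / (n + 1 : ℝ)) * e (i - 1) + ((n + 1 - i) / (n + 1 : ℝ)) * e i)
          = ((n + 2) / (n + 1)) * ∑ i ∈ Finset.range (n + 1), e i := by
        rw [Finset.sum_add_distrib, h1, h2, ← Finset.sum_add_distrib, Finset.mul_sum]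
        refine Finset.sum_congr rfl fun i _ => ?_
        field_simp
        ring
      have h4 : ∑ i ∈ Finset.range (n + 1), e i
          = ∑ i ∈ Finset.range (n + 1), d i + ∑ i ∈ Finset.range (n + 1), w i (n - i) :=
        Finset.sum_add_distrib
      rw [h3, h4, Finset.sum_range_succ (fun k : ℕ =>
        (1 / ((k : ℝ) + 1)) * ∑ i ∈ Finset.range (k + 1), w i (k - i)) n]
      set W := ∑ i ∈ Finset.range (n + 1), w i (n - i)
      set A := ∑ k ∈ Finset.range n,
          (1 / ((k : ℝ) + 1)) * ∑ i ∈ Finset.range (k + 1), w i (k - i)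
      calc ((n + 2) / (n + 1) : ℝ) * (∑ i ∈ Finset.range (n + 1), d i + W)
          ≤ ((n + 2) / (n + 1)) * ((n + 1) * A + W) := by gcongr
        _ = _ := by push_cast; field_simp; ring

/-- If the family `ℓ` has bounded sum over the quadrant and `α > 1/2`, the sums of the averages of
`ℓ ^ α` over antidiagonals are bounded. -/
theorem exists_bound_sum_average_rpow {α : ℝ} (hα : 1 / 2 < α) (hα1 : α < 1) :
    ∃ M : ℝ, ∀ ℓ : ℕ → ℕ → ℝ, (∀ i j, 0 ≤ ℓ i j) →
      (∀ n, ∑ k ∈ Finset.range n, ∑ i ∈ Finset.range (k + 1), ℓ i (k - i) ≤ 1) →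
      ∀ n, ∑ k ∈ Finset.range n,
        (1 / ((k : ℝ) + 1)) * ∑ i ∈ Finset.range (k + 1), ℓ i (k - i) ^ α ≤ M := by
  have h1α : 0 < 1 - α := by linarith
  set β := α / (1 - α) with hβ
  have hβ1 : 1 < β := by rw [hβ, lt_div_iff₀ h1α]; linarith
  have hsum : Summable fun k : ℕ => 1 / ((k : ℝ) + 1) ^ β := by
    have := (summable_nat_add_iff 1).2 (Real.summable_one_div_nat_rpow.2 hβ1)
    simpa using this
  refine ⟨1 + ∑' k : ℕ, 1 / ((k : ℝ) + 1) ^ β, fun ℓ hℓ hle n => ?_⟩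
  have hY : ∀ k i : ℕ, (1 / ((k : ℝ) + 1)) * ℓ i (k - i) ^ α ≤
      ℓ i (k - i) + (1 / ((k : ℝ) + 1)) * (1 / ((k : ℝ) + 1) ^ β) := by
    intro k i
    have hk : (0 : ℝ) < (k : ℝ) + 1 := by positivity
    -- Chosen so that p^(1-α) = 1/(k+1), turning the left side into a weighted geometric mean. The
    -- k+1 copies of `p` add up to (k+1)^(-β), summable because α > 1/2 means β > 1.
    set p : ℝ := (1 / ((k : ℝ) + 1)) * (1 / ((k : ℝ) + 1) ^ β) with hp
    have hp0 : 0 ≤ p := by positivity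
    have h := Real.geom_mean_le_arith_mean2_weighted (w₁ := α) (w₂ := 1 - α) (by linarith)
      h1α.le (hℓ i (k - i)) hp0 (by ring)
    have hpp : p ^ (1 - α) = 1 / ((k : ℝ) + 1) := by
      have : p = ((k : ℝ) + 1) ^ (-(1 / (1 - α))) := by
        rw [hp, one_div, one_div, ← Real.rpow_neg hk.le, ← Real.rpow_neg_one, ← Real.rpow_add hk]
        congr 1
        rw [hβ]
        field_simp
        ring
      rw [this, ← Real.rpow_mul hk.le, one_div ((k : ℝ) + 1), ← Real.rpow_neg_one]
      congr 1
      field_simp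
    rw [hpp] at h
    nlinarith [hℓ i (k - i)]
  calc ∑ k ∈ Finset.range n, (1 / ((k : ℝ) + 1)) * ∑ i ∈ Finset.range (k + 1), ℓ i (k - i) ^ α
      ≤ ∑ k ∈ Finset.range n, (∑ i ∈ Finset.range (k + 1), ℓ i (k - i)
          + 1 / ((k : ℝ) + 1) ^ β) := by
        refine Finset.sum_le_sum fun k _ => ?_
        rw [Finset.mul_sum]
        refine (Finset.sum_le_sum fun i _ => hY k i).trans ?_
        rw [Finset.sum_add_distrib, Finset.sum_const, Finset.card_range, nsmul_eq_mul]
        have hk : (k : ℝ) + 1 ≠ 0 := by positivity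
        have : ((k + 1 : ℕ) : ℝ) * (1 / ((k : ℝ) + 1) * (1 / ((k : ℝ) + 1) ^ β))
            = 1 / ((k : ℝ) + 1) ^ β := by
          push_cast
          field_simp
        rw [this]
    _ ≤ _ := by
        rw [Finset.sum_add_distrib]
        exact add_le_add (hle n) (hsum.sum_le_tsum _ fun k _ => by positivity)

/-- Pairwise disjoint open subintervals of `[0,1]` have total length at most one. -/
theorem sum_length_le_one {ι : Type*} (s : Finset ι) (a b : ι → I) (hab : ∀ i, a i ≤ b i)
    (hd : ∀ i ∈ s, ∀ j ∈ s, i ≠ j → b i ≤ a j ∨ b j ≤ a i) :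
    ∑ i ∈ s, ((b i : ℝ) - a i) ≤ 1 := by
  have hdis : (s : Set ι).PairwiseDisjoint fun i => Set.Ioo (a i : ℝ) (b i) := by
    intro i hi j hj hij
    rw [Function.onFun, Set.disjoint_left]
    rintro x ⟨h1, h2⟩ ⟨h3, h4⟩
    rcases hd i hi j hj hij with h | h
    · exact absurd (show (b i : ℝ) ≤ a j from h) (by linarith)
    · exact absurd (show (b j : ℝ) ≤ a i from h) (by linarith)
  have h1 := MeasureTheory.measure_biUnion_finset (μ := MeasureTheory.volume) hdis
    (fun i _ => measurableSet_Ioo)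
  have h2 : MeasureTheory.volume (⋃ i ∈ s, Set.Ioo (a i : ℝ) (b i)) ≤ 1 := by
    calc _ ≤ MeasureTheory.volume (Set.Icc (0 : ℝ) 1) :=
          MeasureTheory.measure_mono (Set.iUnion₂_subset fun i _ =>
            Set.Ioo_subset_Icc_self.trans (Set.Icc_subset_Icc (a i).2.1 (b i).2.2))
      _ = 1 := by simp
  rw [h1] at h2
  simp only [Real.volume_Ioo] at h2
  rw [← ENNReal.ofReal_sum_of_nonneg fun i _ => sub_nonneg.2 (show (a i : ℝ) ≤ b i from hab i)]
    at h2
  exact ENNReal.ofReal_le_one.1 h2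

/-! ### Free actions of non-cyclic abelian groups with a wandering interval -/

theorem HolderDistortion.mono {C C' α : ℝ} (h : C ≤ C') {f : I → I} (hmono : Monotone f)
    (hf : HolderDistortion C α f) : HolderDistortion C' α f := by
  intro s t u₁ u₂ v₁ v₂ h1 h2 h3 h4 h5 h6
  refine (hf s t u₁ u₂ v₁ v₂ h1 h2 h3 h4 h5 h6).trans ?_
  have hst : 0 ≤ (t : ℝ) - s := sub_nonneg.2 (show (s : ℝ) ≤ t from h1.trans (h2.trans h3))
  have hw : 0 ≤ ((t : ℝ) - s) ^ α := Real.rpow_nonneg hst α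
  refine mul_le_mul_of_nonneg_right (Real.exp_le_exp.2 (mul_le_mul_of_nonneg_right h hw))
    (mul_nonneg (sub_nonneg.2 (hmono h5)) (sub_nonneg.2 h2))

section FreeAction

variable {Γ : Type*} [CommGroup Γ] {φ : Γ →* (I ≃ₜ I)} {A B : I}

/-- By the intermediate value theorem, a change of direction would produce a fixed point. -/
theorem lt_apply_of_lt_apply (hfree : ∀ γ ≠ 1, ∀ y, A < y → y < B → φ γ y ≠ y) {γ : Γ} {y z : I}
    (hy : A < y) (hy' : y < B) (h : y < φ γ y) (hz : A < z) (hz' : z < B) : z < φ γ z := by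
  have hγ : γ ≠ 1 := by
    rintro rfl
    simp at h
  by_contra hc
  obtain ⟨x, hx, hxe⟩ := (isPreconnected_Ioo (a := A) (b := B)).intermediate_value₂
    (a := y) (b := z) ⟨hy, hy'⟩ ⟨hz, hz'⟩ (f := id) (g := φ γ) continuousOn_id
    (φ γ).continuous.continuousOn h.le (not_lt.1 hc)
  exact hfree γ hγ x hx.1 hx.2 hxe.symm

theorem orbitSup_eq_of_free (hφ : ∀ γ, StrictMono (φ γ)) (hB : ∀ γ, φ γ B = B)
    (hfree : ∀ γ ≠ 1, ∀ y, A < y → y < B → φ γ y ≠ y) {γ : Γ} {y : I}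
    (hy : A < y) (hy' : y < B) (hγ : γ ≠ 1) : orbitSup (φ γ) y = B := by
  refine le_antisymm (orbitSup_le_of_fixed hφ (hB γ) hy'.le) (not_lt.1 fun h => ?_)
  exact hfree γ hγ _ (hy.trans_le (le_orbitSup _ _)) h (apply_orbitSup_self (hφ γ) y)

theorem orbitInf_eq_of_free (hφ : ∀ γ, StrictMono (φ γ)) (hA : ∀ γ, φ γ A = A)
    (hfree : ∀ γ ≠ 1, ∀ y, A < y → y < B → φ γ y ≠ y) {γ : Γ} {y : I}
    (hy : A < y) (hy' : y < B) (hγ : γ ≠ 1) : orbitInf (φ γ) y = A := by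
  refine le_antisymm (not_lt.1 fun h => ?_) (le_orbitInf_of_fixed hφ (hA γ) hy.le)
  exact hfree γ hγ _ h ((orbitInf_le _ _).trans_lt hy') (apply_orbitInf_self (hφ γ) y)

/-- An orbit of a free action of a non-cyclic group has no smallest point above a given one. -/
theorem exists_smaller_of_free (hφ : ∀ γ, StrictMono (φ γ)) (hA : ∀ γ, φ γ A = A)
    (hB : ∀ γ, φ γ B = B) (hfree : ∀ γ ≠ 1, ∀ y, A < y → y < B → φ γ y ≠ y) {e₁ e₂ : Γ}
    (hind : ∀ i j : ℤ, e₁ ^ i * e₂ ^ j = 1 → i = 0 ∧ j = 0) {y : I} (hy : A < y) (hy' : y < B)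
    {γ : Γ} (hγ : y < φ γ y) : ∃ γ', y < φ γ' y ∧ φ γ' y < φ γ y := by
  by_contra! hmin
  have hγ1 : γ ≠ 1 := by
    rintro rfl
    simp at hγ
  -- Division with remainder: bring `q y` into the fundamental domain from `y` to `γ y`. Minimality
  -- makes the remainder fix `y`, and freeness makes it trivial.
  have hcyc : ∀ q : Γ, ∃ k : ℤ, q = γ ^ k := by
    intro q
    obtain ⟨k, hk, hk'⟩ := exists_zpow_le_lt hφ hγ (z := φ q y)
      (by rw [orbitInf_eq_of_free hφ hA hfree hy hy' hγ1, ← hA q]; exact hφ q hy)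
      (by rw [orbitSup_eq_of_free hφ hB hfree hy hy' hγ1, ← hB q]; exact hφ q hy')
    have h1 : y ≤ φ (γ ^ (-k) * q) y := by
      rw [action_mul_apply]
      have := (hφ (γ ^ (-k))).monotone hk
      rwa [← action_mul_apply, ← zpow_add, neg_add_cancel, zpow_zero, map_one] at this
    have h2 : φ (γ ^ (-k) * q) y < φ γ y := by
      rw [action_mul_apply]
      have := hφ (γ ^ (-k)) hk'
      rwa [← action_mul_apply (γ ^ (-k)) (γ ^ (k + 1)), ← zpow_add, neg_add_cancel_left,
        zpow_one] at this
    have h3 : φ (γ ^ (-k) * q) y = y := by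
      by_contra hne
      exact absurd (hmin _ (lt_of_le_of_ne h1 (Ne.symm hne))) (not_le.2 h2)
    refine ⟨k, ?_⟩
    by_contra hne
    refine hfree (γ ^ (-k) * q) (fun h => hne ?_) y hy hy' h3
    rw [zpow_neg, inv_mul_eq_one] at h
    exact h.symm
  obtain ⟨k, hk⟩ := hcyc e₁
  obtain ⟨l, hl⟩ := hcyc e₂
  have h0 := hind l (-k) (by rw [hk, hl, ← zpow_mul, ← zpow_mul, ← zpow_add]; simp [mul_comm])
  have hk0 : k = 0 := by omega
  have := (hind 1 0 (by rw [hk, hk0]; simp)).1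
  omega

/-- The slopes of `f` on `[a, b]` differ at most by the factor `exp K`. -/
def SlopesWithin (K : ℝ) (f : I → I) (a b : I) : Prop :=
  ∀ u₁ u₂ v₁ v₂ : I, a ≤ u₁ → u₁ ≤ u₂ → u₂ ≤ b → a ≤ v₁ → v₁ ≤ v₂ → v₂ ≤ b →
    ((f u₂ : ℝ) - f u₁) * (v₂ - v₁) ≤ Real.exp K * (((f v₂ : ℝ) - f v₁) * (u₂ - u₁))

theorem SlopesWithin.mono {K K' : ℝ} (hK : K ≤ K') {f : I → I} (hf : Monotone f) {a b : I}
    (h : SlopesWithin K f a b) : SlopesWithin K' f a b :=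
  fun u₁ u₂ v₁ v₂ h1 h2 h3 h4 h5 h6 => (h u₁ u₂ v₁ v₂ h1 h2 h3 h4 h5 h6).trans
    (mul_le_mul_of_nonneg_right (Real.exp_le_exp.2 hK)
      (mul_nonneg (sub_nonneg.2 (hf h5)) (sub_nonneg.2 h2)))

theorem SlopesWithin.comp {K K' : ℝ} {f g : I → I} (hf : StrictMono f) (hg : StrictMono g)
    {a b : I} (h : SlopesWithin K f a b) (h' : SlopesWithin K' g (f a) (f b)) :
    SlopesWithin (K + K') (g ∘ f) a b := by
  intro u₁ u₂ v₁ v₂ h1 h2 h3 h4 h5 h6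
  have e1 := h u₁ u₂ v₁ v₂ h1 h2 h3 h4 h5 h6
  have e2 := h' (f u₁) (f u₂) (f v₁) (f v₂) (hf.monotone h1) (hf.monotone h2) (hf.monotone h3)
    (hf.monotone h4) (hf.monotone h5) (hf.monotone h6)
  simp only [Function.comp_apply]
  rcases h5.eq_or_lt with rfl | h5
  · simp
  have hq : (0 : ℝ) < f v₂ - f v₁ := sub_pos.2 (hf h5)
  have hY : (0 : ℝ) < g (f v₂) - g (f v₁) := sub_pos.2 (hg (hf h5))
  have hv : (0 : ℝ) < v₂ - v₁ := sub_pos.2 h5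
  refine le_of_mul_le_mul_right ?_ hq
  have hE := Real.exp_pos K'
  rw [Real.exp_add]
  set X := (g (f u₂) : ℝ) - g (f u₁)
  set Y := (g (f v₂) : ℝ) - g (f v₁)
  set p := (f u₂ : ℝ) - f u₁
  set q := (f v₂ : ℝ) - f v₁
  set v := (v₂ : ℝ) - v₁
  set u := (u₂ : ℝ) - u₁
  calc X * v * q = X * q * v := by ring
    _ ≤ Real.exp K' * (Y * p) * v := mul_le_mul_of_nonneg_right e2 hv.le
    _ = Real.exp K' * Y * (p * v) := by ring
    _ ≤ Real.exp K' * Y * (Real.exp K * (q * u)) :=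
        mul_le_mul_of_nonneg_left e1 (mul_pos hE hY).le
    _ = _ := by ring

/-- Along suitable elements `e₁ ^ i * e₂ ^ j` with `i + j = n`, the slopes on a neighbourhood of a
wandering interval are controlled uniformly in `n`. -/
theorem exists_slopesWithin_of_wandering {α : ℝ} (hα : 1 / 2 < α) (hα1 : α < 1)
    (hreg : ∀ γ, IsOrientedC1HolderDiffeo α (φ γ)) {e₁ e₂ : Γ}
    (hind : ∀ i j : ℤ, e₁ ^ i * e₂ ^ j = 1 → i = 0 ∧ j = 0) {a b : I} (hab : a < b)
    (hw : ∀ γ ≠ 1, φ γ b ≤ a ∨ b ≤ φ γ a) :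
    ∃ K : ℝ, ∀ b' : I, b ≤ b' → ((b' : ℝ) - b) * Real.exp K ≤ b - a →
      ∀ n : ℕ, ∃ i ≤ n, SlopesWithin K (φ (e₁ ^ i * e₂ ^ (n - i))) a b' := by
  have hφ : ∀ γ, StrictMono (φ γ) := fun γ => (hreg γ).1
  have hα0 : 0 < α := by linarith
  obtain ⟨M, hM⟩ := exists_bound_sum_average_rpow hα hα1
  obtain ⟨C₁, hC₁, hd₁⟩ := (hreg e₁).exists_holderDistortion hα0
  obtain ⟨C₂, hC₂, hd₂⟩ := (hreg e₂).exists_holderDistortion hα0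
  set C := C₁ + C₂ with hC
  replace hd₁ : HolderDistortion C α (φ e₁) := hd₁.mono (by linarith) (hφ e₁).monotone
  replace hd₂ : HolderDistortion C α (φ e₂) := hd₂.mono (by linarith) (hφ e₂).monotone
  have hC0 : 0 < C := by positivity
  set T : ℕ → ℕ → I → I := fun i j => φ (e₁ ^ i * e₂ ^ j) with hT
  have hTm : ∀ i j, StrictMono (T i j) := fun i j => hφ _
  set ℓ : ℕ → ℕ → ℝ := fun i j => (T i j b : ℝ) - T i j a with hℓ
  have hℓ0 : ∀ i j, 0 < ℓ i j := fun i j => sub_pos.2 (hTm i j hab)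
  have hsum : ∀ n, ∑ k ∈ Finset.range n, ∑ i ∈ Finset.range (k + 1), ℓ i (k - i) ≤ 1 := by
    intro n
    rw [Finset.sum_sigma']
    refine sum_length_le_one _ (fun p : (_ : ℕ) × ℕ => T p.2 (p.1 - p.2) a)
      (fun p => T p.2 (p.1 - p.2) b) (fun p => ((hTm _ _) hab).le) ?_
    rintro ⟨k, i⟩ hi ⟨l, j⟩ hj hne
    simp only [Finset.mem_sigma, Finset.mem_range] at hi hj
    have hγ : (e₁ ^ i * e₂ ^ (k - i))⁻¹ * (e₁ ^ j * e₂ ^ (l - j)) ≠ 1 := by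
      intro h
      have h' := hind ((j : ℤ) - i) (((l - j : ℕ) : ℤ) - (k - i : ℕ)) (by
        rw [zpow_sub, zpow_sub, zpow_natCast, zpow_natCast, zpow_natCast, zpow_natCast, ← h]
        rw [mul_inv]
        exact (mul_mul_mul_comm _ _ _ _).trans (mul_comm _ _))
      apply hne
      have h1 : i = j := by omega
      subst h1
      have h2 : k = l := by omega
      rw [h2]
    simp only [hT]
    generalize e₁ ^ i * e₂ ^ (k - i) = γ₀ at hγ ⊢
    generalize e₁ ^ j * e₂ ^ (l - j) = τ at hγ ⊢
    have key : ∀ y, φ τ y = φ γ₀ (φ (γ₀⁻¹ * τ) y) := fun y => by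
      rw [← action_mul_apply, mul_inv_cancel_left]
    rw [key a, key b]
    rcases hw _ hγ with h | h
    · exact Or.inr ((hφ γ₀).monotone h)
    · exact Or.inl ((hφ γ₀).monotone h)
  -- `M` bounds the summed averages of ℓ^α; 2^α pays for working on `[a, b']`, whose images are at
  -- most twice as long as those of `[a, b]`.
  set K := C * 2 ^ α * M with hK
  refine ⟨K, fun b' hb' hsmall n => ?_⟩
  have hab' : a ≤ b' := hab.le.trans hb'
  have step : ∀ i j κ, κ ≤ K → SlopesWithin κ (T i j) a b' → ∀ f : I → I, StrictMono f →
      HolderDistortion C α f →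
      SlopesWithin (κ + C * (2 ^ α * ℓ i j ^ α)) (f ∘ T i j) a b' := by
    intro i j κ hκ hs f hf hfd
    refine SlopesWithin.comp (hTm i j) hf hs ?_
    have h1 := hs b b' a b hab.le hb' le_rfl le_rfl hab.le hb'
    have hba : (0 : ℝ) < b - a := sub_pos.2 hab
    have hbb : (0 : ℝ) ≤ b' - b := sub_nonneg.2 hb'
    have h2 : Real.exp κ * (b' - b) ≤ b - a :=
      (mul_le_mul_of_nonneg_right (Real.exp_le_exp.2 hκ) hbb).trans (by rwa [mul_comm])
    -- Bootstrap: while the accumulated distortion is at most `K`, the image of `[b, b']` is no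
    -- longer than that of `[a, b]`.
    have h3 : (T i j b' : ℝ) - T i j b ≤ ℓ i j := by
      refine le_of_mul_le_mul_right (h1.trans ?_) hba
      have := mul_le_mul_of_nonneg_left h2 (hℓ0 i j).le
      calc _ = ℓ i j * (Real.exp κ * (b' - b)) := by simp only [hℓ]; ring
        _ ≤ _ := this
    have h4 : (T i j b' : ℝ) - T i j a ≤ 2 * ℓ i j := by
      have : ℓ i j = (T i j b : ℝ) - T i j a := rfl
      linarith
    have h5 : ((T i j b' : ℝ) - T i j a) ^ α ≤ 2 ^ α * ℓ i j ^ α := by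
      rw [← Real.mul_rpow (by norm_num) (hℓ0 i j).le]
      exact Real.rpow_le_rpow (sub_nonneg.2 ((hTm i j).monotone hab')) h4 hα0.le
    exact SlopesWithin.mono (mul_le_mul_of_nonneg_left h5 hC0.le) hf.monotone
      (fun u₁ u₂ v₁ v₂ => hfd _ _ u₁ u₂ v₁ v₂)
  obtain ⟨d, hd, hdsum⟩ := exists_cost_antidiagonal
    -- The condition κ ≤ K is built into the cost because the bootstrap works only below `K`. Step
    -- costs are nonnegative, so the condition passes back to predecessors.
    (P := fun i j κ => κ ≤ K → SlopesWithin κ (T i j) a b')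
    (w := fun i j => C * (2 ^ α * ℓ i j ^ α))
    (fun i j κ κ' h hs hK' => (hs (h.trans hK')).mono h (hTm i j).monotone)
    (by
      intro _ u₁ u₂ v₁ v₂ _ _ _ _ _ _
      simp [hT, mul_comm])
    (by
      intro i j κ hs hK'
      have h0 : 0 ≤ C * (2 ^ α * ℓ i j ^ α) := by have := (hℓ0 i j).le; positivity
      have := step i j κ (by linarith) (hs (by linarith)) _ (hφ e₁) hd₁
      convert this using 1
      ext1 y
      simp only [hT, Function.comp_apply]
      rw [← action_mul_apply]
      congr 2
      rw [pow_succ', mul_assoc])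
    (by
      intro i j κ hs hK'
      have h0 : 0 ≤ C * (2 ^ α * ℓ i j ^ α) := by have := (hℓ0 i j).le; positivity
      have := step i j κ (by linarith) (hs (by linarith)) _ (hφ e₂) hd₂
      convert this using 1
      ext1 y
      simp only [hT, Function.comp_apply]
      rw [← action_mul_apply]
      congr 2
      rw [pow_succ', mul_left_comm]) n
  have havg : ∑ i ∈ Finset.range (n + 1), d i ≤ ∑ i ∈ Finset.range (n + 1), K := by
    rw [Finset.sum_const, Finset.card_range, nsmul_eq_mul]
    push_cast
    refine hdsum.trans (mul_le_mul_of_nonneg_left ?_ (by positivity))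
    have h1 := mul_le_mul_of_nonneg_left (hM ℓ (fun i j => (hℓ0 i j).le) hsum n)
      (show 0 ≤ C * 2 ^ α by positivity)
    refine le_of_eq_of_le ?_ h1
    rw [Finset.mul_sum]
    refine Finset.sum_congr rfl fun k _ => ?_
    rw [Finset.mul_sum, Finset.mul_sum, Finset.mul_sum]
    refine Finset.sum_congr rfl fun i _ => ?_
    ring
  obtain ⟨i, hi, hiK⟩ := Finset.exists_le_of_sum_le ⟨0, by simp⟩ havg
  have hin : i ≤ n := by
    have := Finset.mem_range.1 hi
    omega
  exact ⟨i, hin, (hd i hin hiK).mono hiK (hTm _ _).monotone⟩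

/-- On a far antidiagonal at least one exponent is large, and the other factor also moves `a` to the
right. -/
theorem exists_forall_antidiagonal_close (hφ : ∀ γ, StrictMono (φ γ)) (hB : ∀ γ, φ γ B = B)
    (hfree : ∀ γ ≠ 1, ∀ y, A < y → y < B → φ γ y ≠ y) {e₁ e₂ : Γ} {a : I} (ha : A < a)
    (ha' : a < B) (h₁ : a < φ e₁ a) (h₂ : a < φ e₂ a) {z : I} (hz : z < B) :
    ∃ n : ℕ, ∀ i ≤ n, z < φ (e₁ ^ i * e₂ ^ (n - i)) a := by
  have aux : ∀ e : Γ, a < φ e a → ∃ m : ℕ, ∀ i ≥ m, z < φ (e ^ i) a := by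
    intro e he
    have he1 : e ≠ 1 := by
      rintro rfl
      simp at he
    have hlub := isLUB_orbitSup (φ e) a
    rw [orbitSup_eq_of_free hφ hB hfree ha ha' he1] at hlub
    obtain ⟨_, ⟨k, rfl⟩, hk⟩ := (lt_isLUB_iff hlub).1 hz
    simp only [← map_zpow] at hk
    refine ⟨k.toNat, fun i hi => hk.trans_le ?_⟩
    rw [← zpow_natCast]
    exact (strictMono_zpow_apply hφ he).monotone (by omega)
  have aux' : ∀ e : Γ, a < φ e a → ∀ i : ℕ, a ≤ φ (e ^ i) a := by
    intro e he i
    have := (strictMono_zpow_apply hφ he).monotone (show (0 : ℤ) ≤ i by omega)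
    simpa using this
  obtain ⟨m₁, hm₁⟩ := aux e₁ h₁
  obtain ⟨m₂, hm₂⟩ := aux e₂ h₂
  refine ⟨m₁ + m₂, fun i hi => ?_⟩
  rcases le_total m₁ i with h | h
  · rw [action_mul_apply]
    exact (hm₁ i h).trans_le ((hφ _).monotone (aux' e₂ h₂ _))
  · rw [mul_comm, action_mul_apply]
    exact (hm₂ _ (by omega)).trans_le ((hφ _).monotone (aux' e₁ h₁ _))

/-- A Denjoy theorem on the interval, for generators that move points to the right. -/
theorem not_wandering_of_free_of_lt {α : ℝ} (hα : 1 / 2 < α) (hα1 : α < 1)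
    (hreg : ∀ γ, IsOrientedC1HolderDiffeo α (φ γ)) (hA : ∀ γ, φ γ A = A) (hB : ∀ γ, φ γ B = B)
    (hfree : ∀ γ ≠ 1, ∀ y, A < y → y < B → φ γ y ≠ y) {e₁ e₂ : Γ}
    (hind : ∀ i j : ℤ, e₁ ^ i * e₂ ^ j = 1 → i = 0 ∧ j = 0) {a c : I} (ha : A < a) (ha' : a < B)
    (hac : a < c) (hw : ∀ γ ≠ 1, φ γ c ≤ a ∨ c ≤ φ γ a)
    (h₁ : a < φ e₁ a) (h₂ : a < φ e₂ a) : False := by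
  have hφ : ∀ γ, StrictMono (φ γ) := fun γ => (hreg γ).1
  have hα0 : 0 < α := by linarith
  -- Enlarge the wandering interval until orbit points of `a` accumulate at its right end `b`.
  set b := sInf {t | ∃ γ, a < φ γ a ∧ φ γ a = t} with hb
  have hglb : IsGLB {t | ∃ γ, a < φ γ a ∧ φ γ a = t} b := isGLB_sInf _
  have hble : ∀ γ, a < φ γ a → b ≤ φ γ a := fun γ h => hglb.1 ⟨γ, h, rfl⟩
  have hsmaller : ∀ γ, a < φ γ a → ∃ γ', a < φ γ' a ∧ φ γ' a < φ γ a := fun γ h =>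
    exists_smaller_of_free hφ hA hB hfree hind ha ha' h
  have hblt : ∀ γ, a < φ γ a → b < φ γ a := fun γ h => by
    obtain ⟨γ', h1, h2⟩ := hsmaller γ h
    exact (hble γ' h1).trans_lt h2
  have hne1 : ∀ γ, a < φ γ a → γ ≠ 1 := by
    rintro γ h rfl
    simp at h
  have hab : a < b := by
    refine hac.trans_le (hglb.2 ?_)
    rintro _ ⟨γ, h, rfl⟩
    refine (hw γ (hne1 γ h)).resolve_left fun h' => ?_
    exact absurd ((hφ γ hac).trans_le h') (not_lt.2 h.le)
  have hpos_of_lt : ∀ γ γ', φ γ a < φ γ' a → a < φ (γ⁻¹ * γ') a := fun γ γ' h => by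
    rw [action_mul_apply]
    simpa only [action_inv_apply_self] using hφ γ⁻¹ h
  have hwb : ∀ γ ≠ 1, φ γ b ≤ a ∨ b ≤ φ γ a := by
    intro γ hγ
    rcases lt_trichotomy (φ γ a) a with h | h | h
    · left
      have h1 := hble γ⁻¹ (by simpa only [action_inv_apply_self] using hφ γ⁻¹ h)
      have h2 := (hφ γ).monotone h1
      rwa [← action_mul_apply, mul_inv_cancel, map_one] at h2
    · exact absurd h (hfree γ hγ a ha ha')
    · exact Or.inr (hble γ h)
  obtain ⟨K, hK⟩ := exists_slopesWithin_of_wandering hα hα1 hreg hind hab hwb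
  obtain ⟨κ, hκ, hexp⟩ := (hreg e₁).exists_expandsBy hα0
  have hba : (0 : ℝ) < b - a := sub_pos.2 hab
  -- The 1 meets the smallness condition of the distortion estimate; κ/4 makes the transported
  -- contraction beat the slope bound κ at `B` despite a factor 2.
  set η : ℝ := (b - a) * Real.exp (-K) * min 1 (κ / 4) with hη
  have hη0 : 0 < η := by positivity
  have hbe : (0 : ℝ) < φ e₁ a - b := sub_pos.2 (hblt e₁ h₁)
  obtain ⟨b', hbb', hb'e, hb'η⟩ : ∃ b' : I, b < b' ∧ b' ≤ φ e₁ a ∧ (b' : ℝ) - b ≤ η := by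
    have h0 : (0 : ℝ) < min η (φ e₁ a - b) := lt_min hη0 hbe
    have h1 := min_le_left η ((φ e₁ a : ℝ) - b)
    have h2 := min_le_right η ((φ e₁ a : ℝ) - b)
    refine ⟨⟨b + min η (φ e₁ a - b), by linarith [b.2.1], by linarith [(φ e₁ a).2.2]⟩,
      ?_, ?_, ?_⟩
    · change (b : ℝ) < b + min η (φ e₁ a - b)
      linarith
    · change (b : ℝ) + min η (φ e₁ a - b) ≤ φ e₁ a
      linarith
    · change (b : ℝ) + min η (φ e₁ a - b) - b ≤ η
      linarith
  have hηK : η * Real.exp K = (b - a) * min 1 (κ / 4) := by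
    rw [hη, Real.exp_neg]
    have := Real.exp_pos K
    field_simp
  obtain ⟨_, ⟨γ₂, hγ₂, rfl⟩, hγ₂b⟩ := (isGLB_lt_iff hglb).1 hbb'
  -- A second, smaller orbit point is needed so that all of `γ [a, b]`, and not just `γ a`, lies in
  -- `[b, b']`.
  obtain ⟨γ, hγ, hγγ₂⟩ := hsmaller γ₂ hγ₂
  have hγb : φ γ b ≤ b' := by
    have h1 := (hφ γ).monotone (hble _ (hpos_of_lt γ γ₂ hγγ₂))
    rw [← action_mul_apply, mul_inv_cancel_left] at h1
    exact h1.trans hγ₂b.le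
  have hγe : ∀ y, A < y → y < B → φ γ y < φ e₁ y := by
    intro y hy hy'
    have h1 : a < φ (γ⁻¹ * e₁) a := hpos_of_lt γ e₁ (hγγ₂.trans (hγ₂b.trans_le hb'e))
    have h2 := hφ γ (lt_apply_of_lt_apply hfree ha ha' h1 hy hy')
    rwa [← action_mul_apply, mul_inv_cancel_left] at h2
  obtain ⟨D, hD, hdist⟩ := (hreg γ).exists_holderDistortion hα0
  -- Within ε of `B`, the slopes of `γ` agree up to a factor 2.
  set ε : ℝ := (Real.log 2 / D) ^ (1 / α) with hε
  have hlog : 0 < Real.log 2 := Real.log_pos one_lt_two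
  have hε0 : 0 < ε := by positivity
  have hεα : D * ε ^ α = Real.log 2 := by
    rw [hε, ← Real.rpow_mul (by positivity), one_div_mul_cancel hα0.ne', Real.rpow_one]
    field_simp
  have hB0 : (0 : ℝ) < B := A.2.1.trans_lt (show (A : ℝ) < B from ha.trans ha')
  obtain ⟨n, hn⟩ := exists_forall_antidiagonal_close hφ hB hfree ha ha' h₁ h₂
    (z := ⟨max 0 ((B : ℝ) - ε), le_max_left _ _, max_le zero_le_one (by linarith [B.2.2])⟩)
    (show max 0 ((B : ℝ) - ε) < B from max_lt hB0 (by linarith))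
  obtain ⟨i, hi, hslope⟩ := hK b' hbb'.le (by
    refine (mul_le_mul_of_nonneg_right hb'η (Real.exp_pos K).le).trans ?_
    rw [hηK]
    exact mul_le_of_le_one_right hba.le (min_le_left _ _)) n
  have hclose := hn i hi
  set τ := e₁ ^ i * e₂ ^ (n - i)
  have hya : A < φ τ a := by rw [← hA τ]; exact hφ τ ha
  have hyB : φ τ a < B := by rw [← hB τ]; exact hφ τ ha'
  have hbB : b < B := (hblt e₁ h₁).trans (by rw [← hB e₁]; exact hφ e₁ ha')
  have hybB : φ τ b ≤ B := by rw [← hB τ]; exact (hφ τ hbB).le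
  have hyB' : (0 : ℝ) < B - φ τ a := sub_pos.2 hyB
  have hlen : (0 : ℝ) < φ τ b - φ τ a := sub_pos.2 (hφ τ hab)
  have hcloseε : (B : ℝ) - φ τ a ≤ ε := by
    have h1 : max 0 ((B : ℝ) - ε) < φ τ a := hclose
    linarith [le_max_right 0 ((B : ℝ) - ε)]
  have hcomm : ∀ y, φ τ (φ γ y) = φ γ (φ τ y) := fun y => by
    rw [← action_mul_apply, ← action_mul_apply, mul_comm]
  -- As τ commutes with γ and has bounded distortion, γ contracts `τ [a, b]` about as strongly as
  -- `[a, b]`.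
  have hup : (φ γ (φ τ b) : ℝ) - φ γ (φ τ a) ≤ κ / 4 * (φ τ b - φ τ a) := by
    have h1 := hslope (φ γ a) (φ γ b) a b hγ.le ((hφ γ).monotone hab.le) hγb le_rfl hab.le hbb'.le
    rw [hcomm, hcomm] at h1
    have h2 : (φ γ b : ℝ) - φ γ a ≤ η := by
      have e1 : (φ γ b : ℝ) ≤ b' := hγb
      have e2 : (b : ℝ) ≤ φ γ a := hble γ hγ
      linarith
    refine le_of_mul_le_mul_right (h1.trans ?_) hba
    calc Real.exp K * (((φ τ b : ℝ) - φ τ a) * (φ γ b - φ γ a))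
        ≤ Real.exp K * (((φ τ b : ℝ) - φ τ a) * η) := by gcongr
      _ = (φ τ b - φ τ a) * (η * Real.exp K) := by ring
      _ = (φ τ b - φ τ a) * ((b - a) * min 1 (κ / 4)) := by rw [hηK]
      _ ≤ (φ τ b - φ τ a) * ((b - a) * (κ / 4)) := by
          gcongr
          exact min_le_right _ _
      _ = _ := by ring
  have hlow := hdist (φ τ a) B (φ τ a) B (φ τ a) (φ τ b) le_rfl hyB.le le_rfl le_rfl
    (hφ τ hab).le hybB
  rw [hB γ] at hlow
  have hexp2 : Real.exp (D * ((B : ℝ) - φ τ a) ^ α) ≤ 2 := by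
    rw [← Real.exp_log (show (0 : ℝ) < 2 by norm_num), Real.exp_le_exp, ← hεα]
    gcongr
  -- γ lies below `e₁` and both fix `B`, so the mean slope of γ up to `B` is at least that of `e₁`.
  have hκB : κ * ((B : ℝ) - φ τ a) ≤ B - φ γ (φ τ a) := by
    have h1 := hexp (φ τ a) B hyB.le
    rw [hB e₁] at h1
    have h2 : (φ γ (φ τ a) : ℝ) < φ e₁ (φ τ a) := hγe _ hya hyB
    linarith
  have hfinal : κ * ((B : ℝ) - φ τ a) * (φ τ b - φ τ a)
      ≤ 2 * (κ / 4 * (φ τ b - φ τ a) * (B - φ τ a)) := by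
    calc κ * ((B : ℝ) - φ τ a) * (φ τ b - φ τ a)
        ≤ ((B : ℝ) - φ γ (φ τ a)) * (φ τ b - φ τ a) := by gcongr
      _ ≤ _ := hlow
      _ ≤ 2 * (((φ γ (φ τ b) : ℝ) - φ γ (φ τ a)) * (B - φ τ a)) :=
          mul_le_mul_of_nonneg_right hexp2
            (mul_nonneg (sub_nonneg.2 (hφ γ (hφ τ hab)).le) hyB'.le)
      _ ≤ 2 * (κ / 4 * (φ τ b - φ τ a) * (B - φ τ a)) := by gcongr
  have : 0 < κ * ((B : ℝ) - φ τ a) * (φ τ b - φ τ a) := by positivity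
  nlinarith

/-- A Denjoy theorem on the interval: if an abelian group with two independent elements acts by
`C^{1+α}` diffeomorphisms of `[0,1]` with `α > 1/2`, preserves `(A, B)` and acts freely on it, then
no interval in `(A, B)` is wandering. -/
theorem not_wandering_of_free {α : ℝ} (hα : 1 / 2 < α)
    (hreg : ∀ γ, IsOrientedC1HolderDiffeo α (φ γ)) (hA : ∀ γ, φ γ A = A) (hB : ∀ γ, φ γ B = B)
    (hfree : ∀ γ ≠ 1, ∀ y, A < y → y < B → φ γ y ≠ y) {e₁ e₂ : Γ}
    (hind : ∀ i j : ℤ, e₁ ^ i * e₂ ^ j = 1 → i = 0 ∧ j = 0) {a c : I} (ha : A < a) (ha' : a < B)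
    (hac : a < c) : ∃ γ ≠ 1, a < φ γ c ∧ φ γ a < c := by
  by_contra! hcon
  have hw : ∀ γ ≠ 1, φ γ c ≤ a ∨ c ≤ φ γ a := fun γ hγ => by
    rcases le_or_gt (φ γ c) a with h | h
    · exact Or.inl h
    · exact Or.inr (hcon γ hγ h)
  have hφ : ∀ γ, StrictMono (φ γ) := fun γ => (hreg γ).1
  have hsign : ∀ e : Γ, e ≠ 1 → a < φ e a ∨ a < φ e⁻¹ a := fun e he => by
    rcases lt_trichotomy (φ e a) a with h | h | h
    · exact Or.inr (by simpa only [action_inv_apply_self] using hφ e⁻¹ h)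
    · exact absurd h (hfree e he a ha ha')
    · exact Or.inl h
  have hne₁ : e₁ ≠ 1 := by
    rintro rfl
    have := hind 1 0 (by simp)
    omega
  have hne₂ : e₂ ≠ 1 := by
    rintro rfl
    have := hind 0 1 (by simp)
    omega
  have main : ∀ f₁ f₂ : Γ, (∀ i j : ℤ, f₁ ^ i * f₂ ^ j = 1 → i = 0 ∧ j = 0) → a < φ f₁ a →
      a < φ f₂ a → False := fun f₁ f₂ hi h₁ h₂ =>
    not_wandering_of_free_of_lt (α := min α (3 / 4)) (lt_min hα (by norm_num))
      ((min_le_right _ _).trans_lt (by norm_num))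
      (fun γ => (hreg γ).of_le (lt_min (by linarith) (by norm_num)) (min_le_left _ _))
      hA hB hfree hi ha ha' hac hw h₁ h₂
  rcases hsign e₁ hne₁ with h₁ | h₁ <;> rcases hsign e₂ hne₂ with h₂ | h₂
  · exact main _ _ hind h₁ h₂
  · refine main e₁ e₂⁻¹ (fun i j h => ?_) h₁ h₂
    have := hind i (-j) (by simpa using h)
    omega
  · refine main e₁⁻¹ e₂ (fun i j h => ?_) h₁ h₂
    have := hind (-i) j (by simpa using h)
    omega
  · refine main e₁⁻¹ e₂⁻¹ (fun i j h => ?_) h₁ h₂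
    have := hind (-i) (-j) (by simpa using h)
    omega

end FreeAction

/-! ### Stabilizers of orbit intervals -/

section Stabilizer

variable {G : Type*} [Group G] {ρ : G →* (I ≃ₜ I)}

/-- The stabilizer of the pair of endpoints of `orbitInterval g x`. -/
noncomputable def orbitStabilizer (ρ : G →* (I ≃ₜ I)) (g : G) (x : I) : Subgroup G where
  carrier := {s | ρ s (orbitInf (ρ g) x) = orbitInf (ρ g) x ∧
    ρ s (orbitSup (ρ g) x) = orbitSup (ρ g) x}
  one_mem' := by simp
  mul_mem' := fun {s t} hs ht => by
    constructor
    · rw [action_mul_apply, ht.1, hs.1]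
    · rw [action_mul_apply, ht.2, hs.2]
  inv_mem' := fun {s} hs =>
    ⟨(action_inv_apply_eq_iff s _ _).2 hs.1.symm, (action_inv_apply_eq_iff s _ _).2 hs.2.symm⟩

theorem self_mem_orbitStabilizer (hρ : ∀ g, StrictMono (ρ g)) (g : G) (x : I) :
    g ∈ orbitStabilizer ρ g x :=
  ⟨apply_orbitInf_self (hρ g) x, apply_orbitSup_self (hρ g) x⟩

theorem mem_orbitStabilizer_of_zpow_mem (hρ : ∀ g, StrictMono (ρ g)) {g s : G} {x : I} {n : ℤ}
    (hn : n ≠ 0) (h : s ^ n ∈ orbitStabilizer ρ g x) : s ∈ orbitStabilizer ρ g x :=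
  ⟨fixed_of_zpow_fixed hρ hn h.1, fixed_of_zpow_fixed hρ hn h.2⟩

theorem orbitStabilizer_inv (g : G) (x : I) :
    orbitStabilizer ρ g⁻¹ x = orbitStabilizer ρ g x := by
  ext s
  change (_ ∧ _) ↔ (_ ∧ _)
  rw [map_inv, orbitInf_inv, orbitSup_inv]

/-- If `s`, `t` preserve an orbit interval of a central element `z`, then their commutator is not a
large positive power of `z`. -/
theorem commutator_lt_two (hρ : ∀ g, StrictMono (ρ g)) {z s t : G} {x : I} (hx : x < ρ z x)
    (hs : s ∈ orbitStabilizer ρ z x) (ht : t ∈ orbitStabilizer ρ z x) (hzs : Commute z s)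
    (hzt : Commute z t) {m : ℤ} (hst : s * t = t * s * z ^ m) : m < 2 := by
  by_contra! hm
  have h1 := orbitInf_lt_self hρ hx.ne'
  have h2 := self_lt_orbitSup hρ hx.ne'
  -- Measured in steps of `z`, `s` and `t` displace `x` by `k` and `l`, each up to less than one
  -- step. The two orders of composition therefore differ by less than two.
  obtain ⟨k, hk, hk'⟩ := exists_zpow_le_lt hρ hx (z := ρ s x)
    (by rw [← hs.1]; exact hρ s h1) (by rw [← hs.2]; exact hρ s h2)
  obtain ⟨l, hl, hl'⟩ := exists_zpow_le_lt hρ hx (z := ρ t x)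
    (by rw [← ht.1]; exact hρ t h1) (by rw [← ht.2]; exact hρ t h2)
  have hup : ρ (s * t) x < ρ (z ^ (k + l + 2)) x := by
    calc ρ (s * t) x = ρ s (ρ t x) := action_mul_apply _ _ _
      _ < ρ s (ρ (z ^ (l + 1)) x) := hρ s hl'
      _ = ρ (z ^ (l + 1)) (ρ s x) := by
          rw [← action_mul_apply, ← (hzs.zpow_left _).eq, action_mul_apply]
      _ < ρ (z ^ (l + 1)) (ρ (z ^ (k + 1)) x) := hρ _ hk'
      _ = ρ (z ^ (k + l + 2)) x := by
          rw [← action_mul_apply, ← zpow_add]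
          congr 3
          ring
  have hlow : ρ (z ^ (k + l + m)) x ≤ ρ (s * t) x := by
    calc ρ (z ^ (k + l + m)) x = ρ (z ^ (m + k)) (ρ (z ^ l) x) := by
          rw [← action_mul_apply, ← zpow_add]
          congr 3
          ring
      _ ≤ ρ (z ^ (m + k)) (ρ t x) := (hρ _).monotone hl
      _ = ρ t (ρ (z ^ m) (ρ (z ^ k) x)) := by
          rw [← action_mul_apply, (hzt.zpow_left _).eq, zpow_add, action_mul_apply,
            action_mul_apply]
      _ ≤ ρ t (ρ (z ^ m) (ρ s x)) := (hρ t).monotone ((hρ _).monotone hk)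
      _ = ρ (s * t) x := by
          rw [← action_mul_apply, ← action_mul_apply, hst, mul_assoc t s, ← (hzs.zpow_left m).eq,
            mul_assoc]
  have := (strictMono_zpow_apply hρ hx).lt_iff_lt.1 (hlow.trans_lt hup)
  omega

/-- The stabilizer of an orbit interval of a central element `z` contains no two elements whose
commutator is a nontrivial power of `z`. -/
theorem commutator_eq_zero (hρ : ∀ g, StrictMono (ρ g)) {z s t : G} {x : I} (hx : ρ z x ≠ x)
    (hs : s ∈ orbitStabilizer ρ z x) (ht : t ∈ orbitStabilizer ρ z x) (hz : ∀ g, Commute z g)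
    {r : ℤ} (hst : s * t = t * s * z ^ r) : r = 0 := by
  have main : ∀ w s t : G, ∀ r : ℤ, x < ρ w x → (∀ g, Commute w g) →
      s ∈ orbitStabilizer ρ w x → t ∈ orbitStabilizer ρ w x → s * t = t * s * w ^ r → r ≤ 0 := by
    intro w s t r hw hc hs ht hst
    -- Squaring `s` doubles the commutator exponent, sharpening the bound r < 2 to r ≤ 0. Exchanging
    -- `s` and `t` gives the opposite inequality.
    have h2 : s ^ 2 * t = t * s ^ 2 * w ^ (r * 2) := by
      calc s ^ 2 * t = s * (s * t) := by rw [pow_two, mul_assoc]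
        _ = s * (t * s * w ^ r) := by rw [hst]
        _ = (s * t) * s * w ^ r := by simp only [mul_assoc]
        _ = t * s * (w ^ r * s) * w ^ r := by rw [hst]; simp only [mul_assoc]
        _ = t * s * (s * w ^ r) * w ^ r := by rw [((hc s).zpow_left r).eq]
        _ = t * s ^ 2 * w ^ (r * 2) := by
          rw [mul_two, zpow_add, pow_two]; simp only [mul_assoc]
    have := commutator_lt_two hρ hw (pow_mem hs 2) ht (hc _) (hc _) h2
    omega
  have hts : t * s = s * t * z ^ (-r) := by
    rw [hst, mul_assoc, ← zpow_add, add_neg_cancel, zpow_zero, mul_one]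
  rcases lt_or_gt_of_ne hx with h | h
  · have hw : x < ρ z⁻¹ x := by simpa only [action_inv_apply_self] using hρ z⁻¹ h
    rw [← orbitStabilizer_inv] at hs ht
    have h1 := main z⁻¹ s t (-r) hw (fun g => (hz g).inv_left) hs ht (by simpa using hst)
    have h2 := main z⁻¹ t s r hw (fun g => (hz g).inv_left) ht hs (by simpa using hts)
    omega
  · have h1 := main z s t r h hz hs ht hst
    have h2 := main z t s (-r) h hz ht hs hts
    omega

end Stabilizer

/-! ### Abelian subgroups -/

/-- The homomorphism from `ℤ²` determined by two commuting elements. -/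
def zsqHom {G : Type*} [Group G] (u v : G) (h : Commute u v) : Multiplicative (ℤ × ℤ) →* G where
  toFun p := u ^ p.toAdd.1 * v ^ p.toAdd.2
  map_one' := by simp
  map_mul' p q := by
    rw [toAdd_mul, Prod.fst_add, Prod.snd_add, zpow_add, zpow_add]
    exact (h.zpow_zpow q.toAdd.1 p.toAdd.2).symm.mul_mul_mul_comm _ _ |>.symm

/-- Three commuting independent elements generate a copy of `ℤ³`. -/
theorem nonempty_closure_mulEquiv {G : Type*} [Group G] {u v w : G} (huv : Commute u v)
    (huw : Commute u w) (hvw : Commute v w)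
    (hind : ∀ i j k : ℤ, u ^ i * v ^ j * w ^ k = 1 → i = 0 ∧ j = 0 ∧ k = 0) :
    Nonempty (Subgroup.closure {u, v, w} ≃* Multiplicative (Fin 3 → ℤ)) := by
  let F : Multiplicative (Fin 3 → ℤ) →* G :=
    { toFun := fun n => u ^ n.toAdd 0 * v ^ n.toAdd 1 * w ^ n.toAdd 2
      map_one' := by simp
      map_mul' := fun p q => by
        simp only [toAdd_mul, Pi.add_apply, zpow_add]
        have h1 := ((huw.zpow_zpow (q.toAdd 0) (p.toAdd 2)).mul_left
          (hvw.zpow_zpow (q.toAdd 1) (p.toAdd 2))).symm.mul_mul_mul_comm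
            (u ^ p.toAdd 0 * v ^ p.toAdd 1) (w ^ q.toAdd 2)
        rw [h1, (huv.zpow_zpow (q.toAdd 0) (p.toAdd 1)).symm.mul_mul_mul_comm] }
  have hinj : Function.Injective F := by
    rw [injective_iff_map_eq_one]
    intro n hn
    obtain ⟨h0, h1, h2⟩ := hind _ _ _ hn
    apply Multiplicative.toAdd.injective
    funext i
    fin_cases i
    · exact h0
    · exact h1
    · exact h2
  have hrange : F.range = Subgroup.closure {u, v, w} := by
    apply le_antisymm
    · rintro _ ⟨n, rfl⟩
      have hu : u ∈ Subgroup.closure {u, v, w} := Subgroup.subset_closure (by simp)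
      have hv : v ∈ Subgroup.closure {u, v, w} := Subgroup.subset_closure (by simp)
      have hw : w ∈ Subgroup.closure {u, v, w} := Subgroup.subset_closure (by simp)
      exact mul_mem (mul_mem (zpow_mem hu _) (zpow_mem hv _)) (zpow_mem hw _)
    · rw [Subgroup.closure_le]
      rintro g (rfl | rfl | rfl)
      · exact ⟨Multiplicative.ofAdd (Pi.single 0 1), by simp [F]⟩
      · exact ⟨Multiplicative.ofAdd (Pi.single 1 1), by simp [F]⟩
      · exact ⟨Multiplicative.ofAdd (Pi.single 2 1), by simp [F]⟩
  exact ⟨((MonoidHom.ofInjective hinj).trans (MulEquiv.subgroupCongr hrange)).symm⟩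

/-! ### The elements of `N₄` with vanishing `(2,1)` entry -/

/-- The matrix in `N₄` with first column `(1, i, m, k)` and last row `(k, n, j, 1)`. -/
def heis (i j m n k : ℤ) : N4 :=
  ⟨⟨!![1, 0, 0, 0; i, 1, 0, 0; m, 0, 1, 0; k, n, j, 1],
    !![1, 0, 0, 0; -i, 1, 0, 0; -m, 0, 1, 0; n * i + j * m - k, -n, -j, 1],
    by
      ext a b
      fin_cases a <;> fin_cases b <;> simp [Matrix.mul_apply, Fin.sum_univ_four]
      ring,
    by
      ext a b
      fin_cases a <;> fin_cases b <;> simp [Matrix.mul_apply, Fin.sum_univ_four]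
      ring⟩,
    by
      constructor
      · intro a
        fin_cases a <;> rfl
      · intro a b hab
        fin_cases a <;> fin_cases b <;> first | rfl | exact absurd hab (by decide)⟩

theorem heis_mul (i j m n k i' j' m' n' k' : ℤ) :
    heis i j m n k * heis i' j' m' n' k' =
      heis (i + i') (j + j') (m + m') (n + n') (k + k' + n * i' + j * m') := by
  apply Subtype.ext
  apply Units.ext
  change (!![1, 0, 0, 0; i, 1, 0, 0; m, 0, 1, 0; k, n, j, 1] : Matrix (Fin 4) (Fin 4) ℤ) *
    !![1, 0, 0, 0; i', 1, 0, 0; m', 0, 1, 0; k', n', j', 1] =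
    !![1, 0, 0, 0; i + i', 1, 0, 0; m + m', 0, 1, 0; k + k' + n * i' + j * m', n + n', j + j', 1]
  ext a b
  fin_cases a <;> fin_cases b <;> simp [Matrix.mul_apply, Fin.sum_univ_four]
  ring

/-- Powers of elements of `heis` whose coordinates satisfy the commutation relation. -/
theorem heis_zpow {i j m n : ℤ} (h : n * i + j * m = 0) (k r : ℤ) :
    heis i j m n k ^ r = heis (i * r) (j * r) (m * r) (n * r) (k * r) := by
  have key : ∀ r s : ℤ, heis (i * (r + s)) (j * (r + s)) (m * (r + s)) (n * (r + s)) (k * (r + s))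
      = heis (i * r) (j * r) (m * r) (n * r) (k * r) *
        heis (i * s) (j * s) (m * s) (n * s) (k * s) := fun r s => by
    rw [heis_mul]
    congr 1 <;> first | ring1 | linear_combination (-(r * s)) * h
  let F : Multiplicative ℤ →* N4 := MonoidHom.mk' (fun r => heis (i * r.toAdd) (j * r.toAdd)
    (m * r.toAdd) (n * r.toAdd) (k * r.toAdd)) (fun r s => key r.toAdd s.toAdd)
  have := map_zpow F (Multiplicative.ofAdd 1) r
  rw [← ofAdd_zsmul] at this
  simpa [F] using this.symm

theorem heis_commute {i j m n i' j' m' n' : ℤ} (h : n * i' + j * m' = n' * i + j' * m)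
    (k k' : ℤ) : Commute (heis i j m n k) (heis i' j' m' n' k') := by
  change _ * _ = _ * _
  rw [heis_mul, heis_mul]
  congr 1 <;> first | ring1 | linear_combination h

/-- The generator of the centre of `N₄`. -/
def centralElement : N4 := heis 0 0 0 0 1

theorem centralElement_zpow (r : ℤ) : centralElement ^ r = heis 0 0 0 0 r := by
  rw [centralElement, heis_zpow (by ring)]
  simp

theorem centralElement_ne_one : centralElement ≠ 1 := by
  intro h
  have : (1 : ℤ) = 0 := congrFun (congrFun (congrArg (fun g : N4 =>
    ((g : (Matrix (Fin 4) (Fin 4) ℤ)ˣ) : Matrix (Fin 4) (Fin 4) ℤ)) h) 3) 0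
  omega

theorem centralElement_commute (g : N4) : Commute centralElement g := by
  apply Subtype.ext
  apply Units.ext
  change (!![1, 0, 0, 0; 0, 1, 0, 0; 0, 0, 1, 0; 1, 0, 0, 1] : Matrix (Fin 4) (Fin 4) ℤ) *
    ((g : (Matrix (Fin 4) (Fin 4) ℤ)ˣ) : Matrix (Fin 4) (Fin 4) ℤ) = _ * _
  obtain ⟨h1, h2⟩ := g.2
  change ∀ i j : Fin 4, i < j →
    ((g : (Matrix (Fin 4) (Fin 4) ℤ)ˣ) : Matrix (Fin 4) (Fin 4) ℤ) i j = 0 at h2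
  change ∀ i : Fin 4,
    ((g : (Matrix (Fin 4) (Fin 4) ℤ)ˣ) : Matrix (Fin 4) (Fin 4) ℤ) i i = 1 at h1
  change _ = ((g : (Matrix (Fin 4) (Fin 4) ℤ)ˣ) : Matrix (Fin 4) (Fin 4) ℤ) *
    !![1, 0, 0, 0; 0, 1, 0, 0; 0, 0, 1, 0; 1, 0, 0, 1]
  generalize ((g : (Matrix (Fin 4) (Fin 4) ℤ)ˣ) : Matrix (Fin 4) (Fin 4) ℤ) = M at h1 h2
  have a1 := h1 0
  have a2 := h1 3
  have b1 := h2 0 1 (by decide)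
  have b2 := h2 0 2 (by decide)
  have b3 := h2 0 3 (by decide)
  have b4 := h2 1 3 (by decide)
  have b5 := h2 2 3 (by decide)
  ext a b
  fin_cases a <;> fin_cases b <;>
    simp [Matrix.mul_apply, Fin.sum_univ_four, a1, a2, b1, b2, b3, b4, b5, add_comm]

/-- The exponent is the standard symplectic form on ℤ⁴, pairing `n` with `i` and `j` with `m`. -/
theorem heis_commutator (i j m n i' j' m' n' : ℤ) :
    heis i j m n 0 * heis i' j' m' n' 0 = heis i' j' m' n' 0 * heis i j m n 0 *
      centralElement ^ (n * i' + j * m' - n' * i - j' * m) := by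
  rw [centralElement_zpow, heis_mul, heis_mul, heis_mul]
  congr 1 <;> ring

/-- A subgroup of `N₄` in which no commutator is a nontrivial central element meets some abelian
subgroup of rank two trivially. -/
theorem exists_commute_independent_mod (S : Subgroup N4)
    (hS : ∀ s ∈ S, ∀ t ∈ S, ∀ r : ℤ, s * t = t * s * centralElement ^ r → r = 0) :
    ∃ u v : N4, Commute u v ∧ ∀ m n : ℤ, u ^ m * v ^ n ∈ S → m = 0 ∧ n = 0 := by
  -- The coordinate planes (m,n), (i,j), (i,m) and (j,n) are Lagrangian, so each lifts to a
  -- commuting pair. The vectors of `S` in the first two planes, with one from the third if i = 0 or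
  -- the fourth otherwise, cannot be mutually orthogonal.
  by_contra! hcon
  have hS' : ∀ i j m n i' j' m' n' : ℤ, heis i j m n 0 ∈ S → heis i' j' m' n' 0 ∈ S →
      n * i' + j * m' - n' * i - j' * m = 0 := fun i j m n i' j' m' n' h h' =>
    hS _ h _ h' _ (heis_commutator i j m n i' j' m' n')
  obtain ⟨m, n, hmn, hmn0⟩ := hcon (heis 0 0 1 0 0) (heis 0 0 0 1 0) (heis_commute (by ring) _ _)
  obtain ⟨i, j, hij, hij0⟩ := hcon (heis 1 0 0 0 0) (heis 0 1 0 0 0) (heis_commute (by ring) _ _)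
  rw [heis_zpow (by ring), heis_zpow (by ring), heis_mul] at hmn hij
  simp only [zero_mul, mul_zero, one_mul, add_zero, zero_add] at hmn hij
  have e1 := hS' _ _ _ _ _ _ _ _ hmn hij
  by_cases hi : i = 0
  · obtain ⟨k, l, hkl, hkl0⟩ := hcon (heis 1 0 0 0 0) (heis 0 0 1 0 0)
      (heis_commute (by ring) _ _)
    rw [heis_zpow (by ring), heis_zpow (by ring), heis_mul] at hkl
    simp only [zero_mul, mul_zero, one_mul, add_zero, zero_add] at hkl
    have e2 := hS' _ _ _ _ _ _ _ _ hkl hij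
    have e3 := hS' _ _ _ _ _ _ _ _ hkl hmn
    have hj := hij0 hi
    subst hi
    simp only [mul_zero, zero_mul, zero_sub, neg_eq_zero, mul_eq_zero, zero_add, sub_zero, hj,
      false_or] at e1 e2 e3
    subst e1 e2
    have hn := hmn0 rfl
    rcases e3 with h | h
    · exact hn h
    · exact hkl0 h rfl
  · obtain ⟨k, l, hkl, hkl0⟩ := hcon (heis 0 1 0 0 0) (heis 0 0 0 1 0)
      (heis_commute (by ring) _ _)
    rw [heis_zpow (by ring), heis_zpow (by ring), heis_mul] at hkl
    simp only [zero_mul, mul_zero, one_mul, add_zero, zero_add] at hkl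
    have e2 := hS' _ _ _ _ _ _ _ _ hkl hij
    have e3 := hS' _ _ _ _ _ _ _ _ hkl hmn
    simp only [mul_zero, mul_eq_zero, zero_add, sub_zero, add_zero, hi, or_false] at e2 e3
    subst e2
    rcases e3 with h | h
    · exact hkl0 h rfl
    · subst h
      simp only [mul_zero, sub_zero, add_zero, mul_eq_zero, hi, or_false] at e1
      exact hmn0 rfl e1

/-! ### The main theorem -/

section Main

variable {G : Type*} [Group G] {ρ : G →* (I ≃ₜ I)}

/-- If a rank-two abelian group commuting with `z` moves the interval `J_z(x)`, then one of its
elements moves an orbit interval of another one: otherwise it would act freely on an interval that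
contains the wandering interval `J_z(x)`. -/
theorem exists_not_mem_orbitStabilizer {α : ℝ} (hα : 1 / 2 < α)
    (hreg : ∀ g, IsOrientedC1HolderDiffeo α (ρ g)) {z : G} {x : I} (hx : ρ z x ≠ x)
    (ψ : Multiplicative (ℤ × ℤ) →* G) (hz : ∀ γ, Commute (ψ γ) z)
    (hψ : ∀ γ ≠ 1, ψ γ ∉ orbitStabilizer ρ z x) :
    ∃ γ₁ γ₂, γ₂ ≠ 1 ∧ ψ γ₁ ∉ orbitStabilizer ρ (ψ γ₂) x := by
  by_contra! hfix
  have hρ : ∀ g, StrictMono (ρ g) := fun g => (hreg g).1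
  set ε₁ : Multiplicative (ℤ × ℤ) := Multiplicative.ofAdd (1, 0) with hε₁
  set ε₂ : Multiplicative (ℤ × ℤ) := Multiplicative.ofAdd (0, 1) with hε₂
  have hε : ε₁ ≠ 1 := by decide
  -- If γ₁ fixes the endpoints of J_{γ₂}(x), its orbit of `x` stays between them. By symmetry all
  -- these intervals coincide.
  have hle : ∀ γ₁ ≠ 1, ∀ γ₂ ≠ 1, orbitSup (ρ (ψ γ₁)) x ≤ orbitSup (ρ (ψ γ₂)) x ∧
      orbitInf (ρ (ψ γ₂)) x ≤ orbitInf (ρ (ψ γ₁)) x := fun γ₁ _ γ₂ h₂ =>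
    ⟨orbitSup_le_of_fixed hρ (hfix γ₁ γ₂ h₂).2 (le_orbitSup _ _),
      le_orbitInf_of_fixed hρ (hfix γ₁ γ₂ h₂).1 (orbitInf_le _ _)⟩
  set A := orbitInf (ρ (ψ ε₁)) x with hA
  set B := orbitSup (ρ (ψ ε₁)) x with hB
  have hAγ : ∀ γ ≠ 1, orbitInf (ρ (ψ γ)) x = A := fun γ hγ =>
    le_antisymm (hle ε₁ hε γ hγ).2 (hle γ hγ ε₁ hε).2
  have hBγ : ∀ γ ≠ 1, orbitSup (ρ (ψ γ)) x = B := fun γ hγ =>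
    le_antisymm (hle γ hγ ε₁ hε).1 (hle ε₁ hε γ hγ).1
  have hfixA : ∀ γ, (ρ.comp ψ) γ A = A := fun γ => (hfix γ ε₁ hε).1
  have hfixB : ∀ γ, (ρ.comp ψ) γ B = B := fun γ => (hfix γ ε₁ hε).2
  have hfree : ∀ γ ≠ 1, ∀ y, A < y → y < B → (ρ.comp ψ) γ y ≠ y := by
    intro γ hγ y hy hy' h
    rcases le_total y x with h1 | h1
    · have := le_orbitInf_of_fixed hρ (g := ψ γ) h h1
      rw [hAγ γ hγ] at this
      exact absurd hy (not_lt.2 this)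
    · have := orbitSup_le_of_fixed hρ (g := ψ γ) h h1
      rw [hBγ γ hγ] at this
      exact absurd hy' (not_lt.2 this)
  have hxε : ρ (ψ ε₁) x ≠ x := by
    intro h
    refine hψ ε₁ hε ⟨?_, ?_⟩
    · rw [apply_orbitInf (hρ _) ((hz ε₁).map ρ), h]
    · rw [apply_orbitSup (hρ _) ((hz ε₁).map ρ), h]
  have hAx : A < x := orbitInf_lt_self hρ hxε
  have hxB : x < B := self_lt_orbitSup hρ hxε
  -- Applied to the right part of J_z(x), from `x` to its supremum; `x` is already known to lie in
  -- `(A, B)`.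
  obtain ⟨γ, hγ, h1, h2⟩ := not_wandering_of_free hα (fun γ => hreg (ψ γ)) hfixA hfixB hfree
    (e₁ := ε₁) (e₂ := ε₂) (fun i j h => by
      rw [hε₁, hε₂, ← ofAdd_zsmul, ← ofAdd_zsmul, ← ofAdd_add] at h
      have h' := congrArg Multiplicative.toAdd h
      simpa using h') hAx hxB (self_lt_orbitSup hρ hx)
  have hlt := orbitInf_lt_self hρ hx
  rcases (fixes_or_disjoint hρ (hz γ) hx).resolve_left (hψ γ hγ) with h | h
  · exact absurd (h1.trans_le h) (not_lt.2 hlt.le)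
  · exact absurd (h.trans_lt (hρ (ψ γ) hlt)) (not_lt.2 h2.le)

end Main

theorem mainTheorem4 (α : ℝ) (hα : 1 / 2 < α) (ρ : N4 →* (I ≃ₜ I))
    (hfaithful : Function.Injective ρ)
    (hreg : ∀ g : N4, IsOrientedC1HolderDiffeo α (ρ g)) :
    ∃ (g₁ g₂ g₃ : N4) (x₀ : I),
      (orbitInterval (ρ g₃) x₀).Nontrivial ∧
      Moves (ρ g₂) (orbitInterval (ρ g₃) x₀) ∧
      Moves (ρ g₁) (orbitInterval (ρ g₂) x₀) ∧
      (Commute g₁ g₂ ∧ Commute g₁ g₃ ∧ Commute g₂ g₃) ∧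
      Nonempty (Subgroup.closure {g₁, g₂, g₃} ≃* Multiplicative (Fin 3 → ℤ)) := by
  have hρ : ∀ g, StrictMono (ρ g) := fun g => (hreg g).1
  set z := centralElement
  have hz : ∀ g, Commute g z := fun g => (centralElement_commute g).symm
  obtain ⟨x, hx⟩ : ∃ x, ρ z x ≠ x := by
    by_contra! h
    refine centralElement_ne_one (hfaithful ?_)
    rw [map_one]
    exact Homeomorph.ext h
  obtain ⟨u, v, huv, hind⟩ := exists_commute_independent_mod (orbitStabilizer ρ z x)
    (fun s hs t ht r h => commutator_eq_zero hρ hx hs ht centralElement_commute h)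
  set ψ := zsqHom u v huv
  have hψ : ∀ γ, ψ γ ∈ orbitStabilizer ρ z x → γ = 1 := by
    intro γ hγ
    obtain ⟨h1, h2⟩ := hind _ _ hγ
    exact Multiplicative.toAdd.injective (Prod.ext h1 h2)
  obtain ⟨γ₁, γ₂, hγ₂, hmove⟩ := exists_not_mem_orbitStabilizer hα hreg hx ψ (fun γ => hz _)
    (fun γ hγ h => hγ (hψ γ h))
  have hcomm : ∀ γ γ', Commute (ψ γ) (ψ γ') := fun γ γ' => (Commute.all γ γ').map ψ
  have hx₂ : ρ (ψ γ₂) x ≠ x := by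
    intro h
    refine hγ₂ (hψ γ₂ ⟨?_, ?_⟩)
    · rw [apply_orbitInf (hρ _) ((hz _).map ρ), h]
    · rw [apply_orbitSup (hρ _) ((hz _).map ρ), h]
  refine ⟨ψ γ₁, ψ γ₂, z, x, ?_, ?_, ?_, ⟨hcomm _ _, hz _, hz _⟩, ?_⟩
  · rw [orbitInterval_eq_Icc]
    have h := (orbitInf_lt_self hρ hx).trans (self_lt_orbitSup hρ hx)
    exact ⟨_, Set.left_mem_Icc.2 h.le, _, Set.right_mem_Icc.2 h.le, h.ne⟩
  · exact moves_orbitInterval hρ (hz _) hx fun h => hγ₂ (hψ γ₂ h)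
  · exact moves_orbitInterval hρ (hcomm _ _) hx₂ hmove
  · refine nonempty_closure_mulEquiv (hcomm _ _) (hz _) (hz _) fun i j k h => ?_
    -- A relation puts this product in the stabilizer of J_z(x), which ℤ² meets trivially.
    have hij : γ₁ ^ i * γ₂ ^ j = 1 := by
      refine hψ _ ?_
      rw [map_mul, map_zpow, map_zpow, eq_inv_of_mul_eq_one_left h]
      exact inv_mem (zpow_mem (self_mem_orbitStabilizer hρ z x) k)
    -- Otherwise a nonzero power of γ₁ would be a power of γ₂ and preserve J_{γ₂}(x), so γ₁ would
    -- too.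
    have hi : i = 0 := by
      by_contra hi
      refine hmove (mem_orbitStabilizer_of_zpow_mem hρ hi ?_)
      rw [← map_zpow, eq_inv_of_mul_eq_one_left hij, map_inv, map_zpow]
      exact inv_mem (zpow_mem (self_mem_orbitStabilizer hρ _ x) j)
    subst hi
    have hj : j = 0 := by
      by_contra hj
      rw [zpow_zero, one_mul] at hij
      refine hγ₂ (hψ γ₂ (mem_orbitStabilizer_of_zpow_mem hρ hj ?_))
      rw [← map_zpow, hij, map_one]
      exact one_mem _
    subst hj
    refine ⟨rfl, rfl, ?_⟩
    by_contra hk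
    rw [zpow_zero, zpow_zero, one_mul, one_mul] at h
    exact hx (fixed_of_zpow_fixed hρ hk (by rw [h, map_one]; rfl))
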